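/- Let $\mathcal A$ be a unital complex Banach algebra and let $\Psi=\{\psi_t\}_{t\in\mathbb R^d}$ be a uniformly bounded $d$-parameter automorphism group of $\mathcal A$: each $\psi_t$ is an algebra automorphism, $\psi_s\psi_t=\psi_{s+t}$, and $\sup_t\|\psi_t\|_{\mathcal A\to\mathcal A}<\infty$. Let $C(\mathcal A)=\{a\in\mathcal A:\|\psi_t(a)-a\|_{\mathcal A}\to0 \text{ as } t\to0\}$. Let $\delta_j(a)=\lim_{h\to0}h^{-1}(\psi_{he_j}(a)-a)$, $1\le j\le d$, be the canonical generators, put $\delta^\alpha=\delta_1^{\alpha_1}\cdots\delta_d^{\alpha_d}$, and let $C^k(\mathcal A)=\bigcap_{|\alpha|\le k}\mathcal D(\delta^\alpha,C(\mathcal A))$, where $\mathcal D(\delta^\alpha,C(\mathcal A))$ is the domain of $\delta^\alpha$ as an operator in $C(\mathcal A)$, with norm $\|a\|_{C^k(\mathcal A)}=\sum_{|\alpha|\le k}\frac1{\alpha!}\|\delta^\alpha a\|_{\mathcal A}$. Write $\Delta_ta=\psi_t(a)-a$. For $r>0$, $r=k+\eta$ with $k\in\mathbb N_0$ and $0<\eta\le1$,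 the Hölder–Zygmund space $\Lambda_r(\mathcal A)$ consists of all $a\in C^k(\mathcal A)$ with $$\|a\|_{\Lambda_r(\mathcal A)}=\|a\|_{C^k(\mathcal A)}+\sum_{|\alpha|=k}\ \sup_{t\ne0}|t|^{-\eta}\|\Delta_t^2\,\delta^\alpha a\|_{\mathcal A}<\infty,$$ where $|t|$ is the $1$-norm. Let $\psi\in\mathcal S(\mathbb R^d)$ be real-valued with $\operatorname{supp}\psi\subseteq\{2^{-1}\le|\xi|_2\le2\}$, $\psi(\xi)>0$ for $2^{-1}<|\xi|_2<2$, and $\sum_{k\in\mathbb Z}\psi(2^{-k}\xi)=1$ for all $\xi\ne0$. Put $\phi_{k+1}(\xi)=\psi(2^{-k}\xi)$ for $k\ge0$ and $\phi_0(\xi)=1-\sum_{k\ge0}\psi(2^{-k}\xi)$ (so $\{\phi_k\}_{k\ge0}$ is a dyadic partition of unity), and $\Phi_k=\mathcal F^{-1}\phi_k$, where $\mathcal Ff(\omega)=\int f(x)e^{-2\pi i\omega\cdot x}\,dx$. For $a\in C(\mathcal A)$ let $\Phi_k*a=\int_{\mathbb R^d}\Phi_k(t)\,\psi_{-t}(a)\,dt$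 (the integrand is Bochner integrable). Then for every $r>0$ an element $a\in\mathcal A$ lies in $\Lambda_r(\mathcal A)$ if and only if $a\in C(\mathcal A)$ and $$\sup_{k\ge0}2^{rk}\|\Phi_k*a\|_{\mathcal A}<\infty .$$ Moreover, this supremum defines a norm on the vector space $\Lambda_r(\mathcal A)$ that is equivalent to $\|\cdot\|_{\Lambda_r(\mathcal A)}$. -/

import Mathlib

open Filter Topology MeasureTheory
open scoped ENNReal SchwartzMap FourierTransform

noncomputable section

namespace BanachSmooth

/-- The parameter space `ℝ^d` (Euclidean norm, Lebesgue measure). -/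
abbrev Rd (d : ℕ) : Type := EuclideanSpace ℝ (Fin d)

/-- The `1`-norm `|t| = |t₁| + ⋯ + |t_d|` of `t ∈ ℝ^d`. -/
def l1norm {d : ℕ} (t : Rd d) : ℝ := ∑ i, |t i|

/-- A uniformly bounded `d`-parameter automorphism group acting on the Banach algebra `A`. -/
structure AutomorphismGroup (d : ℕ) (A : Type*) [NormedRing A] [NormedAlgebra ℂ A] where
  /-- The automorphism `ψ_t`. -/
  psi : Rd d → (A ≃ₐ[ℂ] A)
  /-- The group property `ψ_s ψ_t = ψ_{s+t}`. -/
  psi_psi : ∀ (s t : Rd d) (a : A), psi s (psi t a) = psi (s + t) a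
  /-- Uniform boundedness: `sup_t ‖ψ_t‖ < ∞`. -/
  bounded : ∃ M : ℝ, ∀ (t : Rd d) (a : A), ‖psi t a‖ ≤ M * ‖a‖

namespace AutomorphismGroup

variable {d : ℕ} {A : Type*} [NormedRing A] [NormedAlgebra ℂ A] (Ψ : AutomorphismGroup d A)

theorem psi_zero (a : A) : Ψ.psi 0 a = a := by
  have h := Ψ.psi_psi 0 0 a
  rw [add_zero] at h
  exact (Ψ.psi 0).injective h

/-- `C(A)`: the elements `a` with `‖ψ_t(a) - a‖ → 0` as `t → 0`. -/
def contElements : Set A :=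
  {a | Tendsto (fun t : Rd d => ‖Ψ.psi t a - a‖) (𝓝 0) (𝓝 0)}

/-- The orbit `h ↦ ψ_{h e_j}(a)` in the `j`-th coordinate direction. -/
def orbit (j : Fin d) (a : A) (h : ℝ) : A := Ψ.psi (h • EuclideanSpace.single j (1 : ℝ)) a

/-- The canonical generator `δ_j(a) = lim_{h → 0} (ψ_{h e_j}(a) - a) / h`; it is meaningful where
the limit exists, that is, where the orbit of `a` is differentiable at `0`. -/
def gen (j : Fin d) (a : A) : A := deriv (Ψ.orbit j a) 0

/-- The derivative of the orbit at `0` is the limit of the difference quotients above. -/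
theorem hasDerivAt_orbit_iff (j : Fin d) (a b : A) :
    HasDerivAt (Ψ.orbit j a) b 0 ↔
      Tendsto (fun h : ℝ => h⁻¹ • (Ψ.psi (h • EuclideanSpace.single j (1 : ℝ)) a - a))
        (𝓝[≠] 0) (𝓝 b) := by
  rw [hasDerivAt_iff_tendsto_slope_zero]
  simp [orbit, Ψ.psi_zero]

/-- `δ_{j₁} δ_{j₂} ⋯ δ_{j_n} a` for the word `j₁ j₂ ⋯ j_n`. -/
def genWord : List (Fin d) → A → A
  | [], a => a
  | j :: l, a => Ψ.gen j (genWord l a)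

/-- The domain of `δ_{j₁} ⋯ δ_{j_n}` as an operator in `C(A)`: all successive derivatives exist
and lie in `C(A)`. -/
def genWordDomain : List (Fin d) → Set A
  | [] => Ψ.contElements
  | j :: l => {a | a ∈ genWordDomain l ∧ DifferentiableAt ℝ (Ψ.orbit j (Ψ.genWord l a)) 0 ∧
      Ψ.gen j (Ψ.genWord l a) ∈ Ψ.contElements}

end AutomorphismGroup

/-- The word `1⋯1 2⋯2 ⋯ d⋯d` in which the letter `j` occurs `α_j` times. -/
def indexWord {d : ℕ} (α : Fin d → ℕ) : List (Fin d) :=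
  (List.ofFn fun j => List.replicate (α j) j).flatten

/-- The finite set of multi-indices of degree `|α| = n`. -/
def multiIndices (d n : ℕ) : Finset (Fin d → ℕ) := Finset.piAntidiag Finset.univ n

theorem mem_multiIndices {d n : ℕ} (α : Fin d → ℕ) : α ∈ multiIndices d n ↔ ∑ j, α j = n := by
  simp [multiIndices]

namespace AutomorphismGroup

variable {d : ℕ} {A : Type*} [NormedRing A] [NormedAlgebra ℂ A] (Ψ : AutomorphismGroup d A)

/-- `δ^α = δ_1^{α_1} ⋯ δ_d^{α_d}`. -/
def genPow (α : Fin d → ℕ) (a : A) : A := Ψ.genWord (indexWord α) a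

/-- The space `C^k(A)`: the intersection of the domains of `δ^α` in `C(A)` over `|α| ≤ k`. -/
def Ck (k : ℕ) : Set A :=
  {a | ∀ α : Fin d → ℕ, ∑ j, α j ≤ k → a ∈ Ψ.genWordDomain (indexWord α)}

/-- The norm `∑_{|α| ≤ k} ‖δ^α a‖ / α!` of `C^k(A)`. -/
def CkNorm (k : ℕ) (a : A) : ℝ :=
  ∑ n ∈ Finset.range (k + 1), ∑ α ∈ multiIndices d n,
    (∏ j, ((α j).factorial : ℝ))⁻¹ * ‖Ψ.genPow α a‖

/-- The first difference `Δ_t a = ψ_t(a) - a`. -/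
def diff (t : Rd d) (a : A) : A := Ψ.psi t a - a

/-- The Hölder–Zygmund seminorm `sup_{t ≠ 0} |t|^{-η} ‖Δ_t² a‖`, possibly infinite. -/
def zygmundSeminorm (η : ℝ) (a : A) : ℝ≥0∞ :=
  ⨆ (t : Rd d) (_ : t ≠ 0), ENNReal.ofReal (l1norm t ^ (-η) * ‖Ψ.diff t (Ψ.diff t a)‖)

end AutomorphismGroup

/-- For `r > 0`, the integer `k ≥ 0` in the decomposition `r = k + η`, `0 < η ≤ 1`. -/
def intPart (r : ℝ) : ℕ := ⌈r⌉₊ - 1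

/-- For `r > 0`, the number `η` in the decomposition `r = k + η`, `0 < η ≤ 1`. -/
def fracPart (r : ℝ) : ℝ := r - intPart r

theorem intPart_add (k : ℕ) {η : ℝ} (h0 : 0 < η) (h1 : η ≤ 1) : intPart (k + η) = k := by
  have h : ⌈(k : ℝ) + η⌉₊ = k + 1 := by
    rw [Nat.ceil_eq_iff (by omega)]
    push_cast
    constructor <;> simp <;> linarith
  simp [intPart, h]

theorem fracPart_add (k : ℕ) {η : ℝ} (h0 : 0 < η) (h1 : η ≤ 1) : fracPart (k + η) = η := by
  simp [fracPart, intPart_add k h0 h1]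

namespace AutomorphismGroup

variable {d : ℕ} {A : Type*} [NormedRing A] [NormedAlgebra ℂ A] (Ψ : AutomorphismGroup d A)

/-- The Hölder–Zygmund norm
`‖a‖_{Λ_r(A)} = ‖a‖_{C^k(A)} + ∑_{|α| = k} |δ^α a|_{Λ_η}`, where `r = k + η`, `0 < η ≤ 1`;
meaningful for `a ∈ C^k(A)`, possibly infinite. -/
def zygmundNorm (r : ℝ) (a : A) : ℝ≥0∞ :=
  ENNReal.ofReal (Ψ.CkNorm (intPart r) a) +
    ∑ α ∈ multiIndices d (intPart r), Ψ.zygmundSeminorm (fracPart r) (Ψ.genPow α a)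

/-- The Hölder–Zygmund space `Λ_r(A)`, `r > 0`. -/
def zygmundSpace (r : ℝ) : Set A := {a | a ∈ Ψ.Ck (intPart r) ∧ Ψ.zygmundNorm r a < ∞}

/-- The action `f * a = ∫ f(t) ψ_{-t}(a) dt` of an integrable function `f` on `a ∈ C(A)`. -/
def action (f : Rd d → ℂ) (a : A) : A := ∫ t, f t • Ψ.psi (-t) a

/-- The quantity `sup_{k ≥ 0} 2^{rk} ‖Φ_k * a‖`, possibly infinite, where `Φ_k` is the inverse
Fourier transform of `φ_k`. -/
def littlewoodPaley (φ : ℕ → Rd d → ℝ) (r : ℝ) (a : A) : ℝ≥0∞ :=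
  ⨆ k : ℕ, ENNReal.ofReal ((2 : ℝ) ^ (r * k) *
    ‖Ψ.action (𝓕⁻ (fun ξ : Rd d => (φ k ξ : ℂ))) a‖)

end AutomorphismGroup

/-- `φ_0, φ_1, …` is a dyadic partition of unity on `ℝ^d`. -/
def IsDyadicPartition {d : ℕ} (φ : ℕ → Rd d → ℝ) : Prop :=
  ∃ ψ : 𝓢(Rd d, ℝ),
    tsupport ψ ⊆ {ξ | 2⁻¹ ≤ ‖ξ‖ ∧ ‖ξ‖ ≤ 2} ∧
    (∀ ξ : Rd d, 2⁻¹ < ‖ξ‖ → ‖ξ‖ < 2 → 0 < ψ ξ) ∧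
    (∀ ξ : Rd d, ξ ≠ 0 → HasSum (fun k : ℤ => ψ ((2 : ℝ) ^ (-k) • ξ)) 1) ∧
    (∀ (k : ℕ) (ξ : Rd d), φ (k + 1) ξ = ψ ((2 : ℝ) ^ (-(k : ℤ)) • ξ)) ∧
    (∀ ξ : Rd d, φ 0 ξ = 1 - ∑' k : ℕ, ψ ((2 : ℝ) ^ (-(k : ℤ)) • ξ))

end BanachSmooth

end

/-!
The proof rests on a functional calculus. For a smooth compactly supported symbol `m` on frequency
space, `m(D) a = (𝓕⁻¹ m) * a` (`mult`) is a bounded operator on `C(A)`, multiplicative in `m`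
(`mult_mul`). The automorphism `ψ_s` acts as multiplication of the symbol by `e^{2πi ξ·s}`
(`psi_mult_eq`), the generator `δ_j` as multiplication by `2πi ξ_j` (`hasDerivAt_orbit_mult`), and
the bound `M ‖𝓕⁻¹ m‖₁` for the norm of `m(D)` does not change when `m` is dilated
(`symbolNorm_comp_smul`).

*Smoothness implies decay.* On the annulus `1/2 ≤ ‖ξ‖ ≤ 2` the symbols
`(2πi ξ_j)^k (e^{2πi ξ_j / 4} - 1)²` of the operators `Δ_s² δ_j^k`, `s = e_j / 4`, have no common
zero. The function `ψ` that generates the partition is therefore a combination of them with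
multipliers as coefficients (`IsMultiplier.exists_eq_sum_diffSymbol`). Dilation by `λ = 2ⁿ` bounds
`‖Φ_{n+1} * a‖` by `λ^{-k} ∑_j ‖Δ_{s/λ}² δ_j^k a‖`, which is of order `λ^{-k-η} = 2^{-nr}`.
No symmetry of `ψ` is required, and only the pure derivatives `δ_j^k` enter.

*Decay implies smoothness.* The partial sums of `∑ Φ_n * a` are dilates of `φ₀(D)` applied to `a`
and converge to `a` (`tendsto_sum_mult`). The `n`-th term is fixed by `φ₀(2^{-n} D / 4)`, so
applying `δ_w` to it costs at most a factor `2^{n |w|}` (Bernstein's inequality,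
`norm_mult_wordSymbol_le`). As the generators are closed, `δ_w a` is the sum of the differentiated
series for `|w| < r` (`IsDyadicExpansion.mem_genWordDomain`). Finally
`‖Δ_t² b‖ ≤ C min (‖b‖, |t|² ∑ ‖δ_i δ_j b‖)`, applied to every term of this series, gives a sum of
order `|t|^η` because `η < 2` (`norm_le_of_hasSum_of_two_bounds`).
-/

/-! ### Multipliers and their kernels -/

namespace BanachSmooth

open scoped ContDiff LineDeriv

variable {d : ℕ}

/-- A Fourier multiplier, here always a smooth compactly supported function on frequency space. -/
structure IsMultiplier (m : Rd d → ℂ) : Prop where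
  smooth : ContDiff ℝ ∞ m
  compact : HasCompactSupport m

/-- The character `ξ ↦ e^{2πi ξ·s}`. -/
noncomputable def character (s ξ : Rd d) : ℂ :=
  Complex.exp ((2 * Real.pi * inner ℝ ξ s : ℝ) * Complex.I)

/-- The symbol `ξ ↦ 2πi ξ_j` of the generator `δ_j`. -/
noncomputable def genSymbol (j : Fin d) (ξ : Rd d) : ℂ := 2 * Real.pi * Complex.I * (ξ j : ℂ)

theorem contDiff_character (s : Rd d) : ContDiff ℝ ∞ (character s) := by
  unfold character
  have h : ContDiff ℝ ∞ fun ξ : Rd d => (2 * Real.pi * inner ℝ ξ s : ℝ) :=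
    contDiff_const.mul (contDiff_id.inner ℝ contDiff_const)
  exact ((Complex.ofRealCLM.contDiff.comp h).mul contDiff_const).cexp

theorem contDiff_genSymbol (j : Fin d) : ContDiff ℝ ∞ (genSymbol (d := d) j) := by
  unfold genSymbol
  have h : ContDiff ℝ ∞ fun ξ : Rd d => ξ j := by fun_prop
  exact contDiff_const.mul (Complex.ofRealCLM.contDiff.comp h)

namespace IsMultiplier

variable {m m₁ m₂ : Rd d → ℂ}

theorem mul_left {g : Rd d → ℂ} (hm : IsMultiplier m) (hg : ContDiff ℝ ∞ g) :
    IsMultiplier fun ξ => g ξ * m ξ :=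
  ⟨hg.mul hm.smooth, hm.compact.mul_left⟩

theorem add (h₁ : IsMultiplier m₁) (h₂ : IsMultiplier m₂) : IsMultiplier fun ξ => m₁ ξ + m₂ ξ :=
  ⟨h₁.smooth.add h₂.smooth, h₁.compact.add h₂.compact⟩

theorem sum {ι : Type*} {s : Finset ι} {f : ι → Rd d → ℂ} (hf : ∀ i ∈ s, IsMultiplier (f i)) :
    IsMultiplier fun ξ => ∑ i ∈ s, f i ξ := by
  classical
  induction s using Finset.induction_on with
  | empty => exact ⟨by simpa using contDiff_const, by simpa using! HasCompactSupport.zero⟩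
  | insert i s hi ih =>
    simp only [Finset.sum_insert hi]
    exact (hf i (by simp)).add (ih fun k hk => hf k (by simp [hk]))

theorem comp_smul {c : ℝ} (hm : IsMultiplier m) (hc : c ≠ 0) : IsMultiplier fun ξ => m (c • ξ) :=
  ⟨hm.smooth.comp (contDiff_const_smul c), hm.compact.comp_smul hc⟩

/-- The multiplier as a Schwartz function. -/
noncomputable def schwartz (hm : IsMultiplier m) : 𝓢(Rd d, ℂ) :=
  hm.compact.toSchwartzMap hm.smooth

theorem coe_schwartz (hm : IsMultiplier m) : ⇑hm.schwartz = m := rfl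

theorem coe_fourierInv_schwartz (hm : IsMultiplier m) : ⇑(𝓕⁻ hm.schwartz : 𝓢(Rd d, ℂ)) = 𝓕⁻ m := by
  rw [SchwartzMap.fourierInv_coe, coe_schwartz]

theorem integrable_kernel (hm : IsMultiplier m) : Integrable (𝓕⁻ m) := by
  rw [← hm.coe_fourierInv_schwartz]
  exact (𝓕⁻ hm.schwartz : 𝓢(Rd d, ℂ)).integrable

theorem continuous_kernel (hm : IsMultiplier m) : Continuous (𝓕⁻ m) := by
  rw [← hm.coe_fourierInv_schwartz]
  exact (𝓕⁻ hm.schwartz : 𝓢(Rd d, ℂ)).continuous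

theorem integral_kernel (hm : IsMultiplier m) : ∫ t, 𝓕⁻ m t = m 0 := by
  have h : 𝓕 (𝓕⁻ hm.schwartz) = hm.schwartz := FourierTransform.fourier_fourierInv_eq _
  have h0 := congrArg (fun f : 𝓢(Rd d, ℂ) => f 0) h
  simp only [SchwartzMap.fourier_coe, hm.coe_fourierInv_schwartz, hm.coe_schwartz] at h0
  rw [← h0, Real.fourier_eq']
  simp

theorem kernel_mul (h₁ : IsMultiplier m₁) (h₂ : IsMultiplier m₂) (t : Rd d) :
    𝓕⁻ (fun ξ => m₁ ξ * m₂ ξ) t = ∫ s, 𝓕⁻ m₁ s * 𝓕⁻ m₂ (t - s) := by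
  have h := SchwartzMap.convolution_apply (ContinuousLinearMap.mul ℂ ℂ)
    (𝓕⁻ h₁.schwartz) (𝓕⁻ h₂.schwartz) t
  have h' : SchwartzMap.convolution (ContinuousLinearMap.mul ℂ ℂ)
      (𝓕⁻ h₁.schwartz) (𝓕⁻ h₂.schwartz) = 𝓕⁻ (h₁.mul_left (g := m₂) h₂.smooth).schwartz := by
    have : SchwartzMap.pairing (ContinuousLinearMap.mul ℂ ℂ) h₁.schwartz h₂.schwartz =
        (h₁.mul_left (g := m₂) h₂.smooth).schwartz := by
      ext ξ
      rw [SchwartzMap.pairing_apply_apply]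
      simp [coe_schwartz, mul_comm]
    rw [← this, SchwartzMap.convolution]
    simp
  rw [h', coe_fourierInv_schwartz, convolution_def] at h
  simp only [coe_fourierInv_schwartz, ContinuousLinearMap.mul_apply'] at h
  rw [← h]
  simp only [mul_comm]

end IsMultiplier

theorem kernel_character_mul (m : Rd d → ℂ) (s t : Rd d) :
    𝓕⁻ (fun ξ => character s ξ * m ξ) t = 𝓕⁻ m (t + s) := by
  rw [Real.fourierInv_eq', Real.fourierInv_eq']
  congr 1
  funext ξ
  simp only [smul_eq_mul, character, ← mul_assoc]
  rw [← Complex.exp_add, ← add_mul, ← Complex.ofReal_add, ← mul_add, ← inner_add_right]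

theorem kernel_comp_smul (m : Rd d → ℂ) {c : ℝ} (hc : 0 < c) (t : Rd d) :
    𝓕⁻ (fun ξ => m (c⁻¹ • ξ)) t = ((c ^ d : ℝ) : ℂ) * 𝓕⁻ m (c • t) := by
  rw [Real.fourierInv_eq', Real.fourierInv_eq']
  have h := Measure.integral_comp_smul (volume : Measure (Rd d))
    (fun ξ => Complex.exp ((2 * Real.pi * inner ℝ ξ (c • t) : ℝ) * Complex.I) • m ξ) c⁻¹
  have h2 : ∀ ξ : Rd d, inner ℝ (c⁻¹ • ξ) (c • t) = inner ℝ ξ t := fun ξ => by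
    rw [inner_smul_left, inner_smul_right]
    simp [hc.ne']
  simp only [h2] at h
  rw [h]
  have h3 : |((c⁻¹ : ℝ) ^ Module.finrank ℝ (Rd d))⁻¹| = c ^ d := by
    simp [abs_of_pos hc]
  rw [h3]
  simp

/-- Multiplying by the symbol of `δ_j` differentiates the kernel in the direction `e_j`. -/
theorem IsMultiplier.hasDerivAt_kernel {m : Rd d → ℂ} (hm : IsMultiplier m) (j : Fin d)
    (t : Rd d) (h : ℝ) :
    HasDerivAt (fun h : ℝ => 𝓕⁻ m (t + h • EuclideanSpace.single j (1 : ℝ)))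
      (𝓕⁻ (fun ξ => genSymbol j ξ * m ξ) (t + h • EuclideanSpace.single j (1 : ℝ))) h := by
  set e : Rd d := EuclideanSpace.single j (1 : ℝ) with he
  have h1 := SchwartzMap.lineDerivOp_fourierInv_eq hm.schwartz e
  have h2 : (2 * Real.pi * Complex.I) • SchwartzMap.smulLeftCLM ℂ (inner ℝ · e) hm.schwartz =
      (hm.mul_left (contDiff_genSymbol j)).schwartz := by
    ext ξ
    have : (inner ℝ · e : Rd d → ℝ).HasTemperateGrowth := by fun_prop
    rw [_root_.smul_apply, SchwartzMap.smulLeftCLM_apply_apply this]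
    simp [coe_schwartz, genSymbol, he, EuclideanSpace.inner_single_right, mul_assoc]
  rw [h2] at h1
  have h3 := congrArg (fun f : 𝓢(Rd d, ℂ) => f (t + h • e)) h1
  simp only [SchwartzMap.lineDerivOp_apply_eq_fderiv, coe_fourierInv_schwartz] at h3
  rw [← h3, ← hm.coe_fourierInv_schwartz]
  have h4 := ((𝓕⁻ hm.schwartz : 𝓢(Rd d, ℂ)).differentiableAt (x := t + h • e)).hasFDerivAt
  have h5 : HasDerivAt (fun h : ℝ => t + h • e) e h := by
    simpa using ((hasDerivAt_id h).smul_const e).const_add t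
  exact h4.comp_hasDerivAt h h5

/-- Kernels decay, uniformly under translations of length at most `1`, like an integrable
function. -/
theorem IsMultiplier.exists_kernel_bound {m : Rd d → ℂ} (hm : IsMultiplier m) :
    ∃ g : Rd d → ℝ, Integrable g ∧ ∀ t s : Rd d, ‖s‖ ≤ 1 → ‖𝓕⁻ m (t + s)‖ ≤ g t := by
  obtain ⟨C, hC⟩ := (𝓕⁻ hm.schwartz : 𝓢(Rd d, ℂ)).decay (d + 1) 0
  obtain ⟨C', hC'⟩ := (𝓕⁻ hm.schwartz : 𝓢(Rd d, ℂ)).decay 0 0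
  simp only [norm_iteratedFDeriv_zero, pow_zero, one_mul, coe_fourierInv_schwartz] at hC hC'
  have key : ∀ t : Rd d, (1 + ‖t‖) ^ (d + 1) * ‖𝓕⁻ m t‖ ≤ 2 ^ d * (C' + C) := fun t => by
    have h := add_pow_le (zero_le_one) (norm_nonneg t) (d + 1)
    simp only [Nat.add_sub_cancel, one_pow] at h
    calc _ ≤ (2 ^ d * (1 + ‖t‖ ^ (d + 1))) * ‖𝓕⁻ m t‖ := by gcongr
      _ = 2 ^ d * (‖𝓕⁻ m t‖ + ‖t‖ ^ (d + 1) * ‖𝓕⁻ m t‖) := by ring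
      _ ≤ _ := by gcongr; exacts [hC'.2 t, hC.2 t]
  refine ⟨fun t => 2 ^ (d + 1) * (2 ^ d * (C' + C)) * (1 + ‖t‖) ^ (-((d : ℝ) + 1)), ?_, ?_⟩
  · exact (integrable_one_add_norm (by simp)).const_mul _
  · intro t s hs
    have h1 : 1 + ‖t‖ ≤ 2 * (1 + ‖t + s‖) := by
      have := norm_sub_le (t + s) s
      rw [add_sub_cancel_right] at this
      linarith [norm_nonneg (t + s)]
    have h2 : (1 + ‖t‖) ^ (d + 1) * ‖𝓕⁻ m (t + s)‖ ≤ 2 ^ (d + 1) * (2 ^ d * (C' + C)) := by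
      calc _ ≤ (2 * (1 + ‖t + s‖)) ^ (d + 1) * ‖𝓕⁻ m (t + s)‖ := by gcongr
        _ = 2 ^ (d + 1) * ((1 + ‖t + s‖) ^ (d + 1) * ‖𝓕⁻ m (t + s)‖) := by rw [mul_pow]; ring
        _ ≤ _ := mul_le_mul_of_nonneg_left (key (t + s)) (by positivity)
    have h3 : (1 + ‖t‖) ^ (-((d : ℝ) + 1)) = ((1 + ‖t‖) ^ (d + 1))⁻¹ := by
      rw [Real.rpow_neg (by positivity), ← Real.rpow_natCast]; push_cast; rfl
    simp only [h3]
    rw [← div_eq_mul_inv, le_div_iff₀ (by positivity), mul_comm]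
    exact h2

end BanachSmooth

/-! ### The functional calculus -/

namespace BanachSmooth

open scoped ContDiff

namespace AutomorphismGroup

variable {d : ℕ} {A : Type*} [NormedRing A] [NormedAlgebra ℂ A] (Ψ : AutomorphismGroup d A)

/-- A constant `M ≥ 1` with `‖ψ_t‖ ≤ M` for all `t`. -/
noncomputable def bound : ℝ := max 1 Ψ.bounded.choose

theorem one_le_bound : 1 ≤ Ψ.bound := le_max_left _ _

theorem bound_nonneg : 0 ≤ Ψ.bound := zero_le_one.trans Ψ.one_le_bound

theorem norm_psi_le (t : Rd d) (a : A) : ‖Ψ.psi t a‖ ≤ Ψ.bound * ‖a‖ :=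
  (Ψ.bounded.choose_spec t a).trans
    (mul_le_mul_of_nonneg_right (le_max_right _ _) (norm_nonneg a))

/-- The automorphism `ψ_t` as a bounded operator. -/
noncomputable def psiCLM (t : Rd d) : A →L[ℂ] A :=
  (Ψ.psi t).toLinearMap.mkContinuous Ψ.bound (Ψ.norm_psi_le t)

@[simp] theorem psiCLM_apply (t : Rd d) (a : A) : Ψ.psiCLM t a = Ψ.psi t a := rfl

theorem norm_diff_le (t : Rd d) (a : A) : ‖Ψ.diff t a‖ ≤ 2 * Ψ.bound * ‖a‖ := by
  have h1 := norm_sub_le (Ψ.psi t a) a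
  have h2 := Ψ.norm_psi_le t a
  have h3 : ‖a‖ ≤ Ψ.bound * ‖a‖ := le_mul_of_one_le_left (norm_nonneg a) Ψ.one_le_bound
  unfold diff
  linarith

/-- `C(A)` as a linear subspace. -/
noncomputable def contSubmodule : Submodule ℂ A where
  carrier := Ψ.contElements
  zero_mem' := by simp [contElements]
  add_mem' := by
    intro a b ha hb
    refine squeeze_zero (fun _ => norm_nonneg _) (fun t => ?_) (by simpa using Tendsto.add ha hb)
    rw [map_add, add_sub_add_comm]
    exact norm_add_le _ _
  smul_mem' := by
    intro c a ha
    refine squeeze_zero (fun _ => norm_nonneg _) (fun t => ?_)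
      (by simpa using Tendsto.const_mul ‖c‖ ha)
    rw [map_smul, ← smul_sub, norm_smul]

theorem isClosed_contElements : IsClosed Ψ.contElements := by
  refine isClosed_of_closure_subset fun a ha => ?_
  refine Metric.tendsto_nhds.2 fun ε hε => ?_
  have hM : 0 < Ψ.bound + 2 := by linarith [Ψ.one_le_bound]
  obtain ⟨b, hb, hab⟩ := Metric.mem_closure_iff.1 ha (ε / (Ψ.bound + 2)) (by positivity)
  filter_upwards [Metric.tendsto_nhds.1 hb (ε / (Ψ.bound + 2)) (by positivity)] with t ht
  rw [dist_eq_norm] at hab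
  simp only [dist_zero_right, norm_norm] at ht ⊢
  have h1 : Ψ.psi t a - a = Ψ.psi t (a - b) + (Ψ.psi t b - b) - (a - b) := by
    rw [map_sub]; abel
  calc ‖Ψ.psi t a - a‖ ≤ ‖Ψ.psi t (a - b)‖ + ‖Ψ.psi t b - b‖ + ‖a - b‖ := by
        rw [h1]; exact (norm_sub_le _ _).trans (by gcongr; exact norm_add_le _ _)
    _ < Ψ.bound * (ε / (Ψ.bound + 2)) + ε / (Ψ.bound + 2) + ε / (Ψ.bound + 2) := by
        have := mul_le_mul_of_nonneg_left hab.le Ψ.bound_nonneg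
        linarith [Ψ.norm_psi_le t (a - b)]
    _ = ε := by field_simp; ring

theorem psi_mem_contElements {a : A} (ha : a ∈ Ψ.contElements) (s : Rd d) :
    Ψ.psi s a ∈ Ψ.contElements := by
  refine squeeze_zero (fun _ => norm_nonneg _) (fun t => ?_)
    (by simpa using Tendsto.const_mul Ψ.bound ha)
  rw [Ψ.psi_psi, add_comm, ← Ψ.psi_psi, ← map_sub]
  exact Ψ.norm_psi_le _ _

theorem diff_mem_contElements {a : A} (ha : a ∈ Ψ.contElements) (s : Rd d) :
    Ψ.diff s a ∈ Ψ.contElements :=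
  Ψ.contSubmodule.sub_mem (Ψ.psi_mem_contElements ha s) ha

theorem continuous_psi {a : A} (ha : a ∈ Ψ.contElements) : Continuous fun t => Ψ.psi t a := by
  refine continuous_iff_continuousAt.2 fun s => ?_
  refine tendsto_iff_norm_sub_tendsto_zero.2 ?_
  have h0 : Tendsto (fun t => t - s) (𝓝 s) (𝓝 0) := tendsto_sub_nhds_zero_iff.2 tendsto_id
  have h1 : Tendsto (fun t => ‖Ψ.psi t (Ψ.psi s a) - Ψ.psi s a‖) (𝓝 0) (𝓝 0) :=
    Ψ.psi_mem_contElements ha s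
  have h : Tendsto (fun t => ‖Ψ.psi (t - s) (Ψ.psi s a) - Ψ.psi s a‖) (𝓝 s) (𝓝 0) := h1.comp h0
  simpa [Ψ.psi_psi] using h

theorem integrable_action {f : Rd d → ℂ} (hf : Integrable f) {a : A} (ha : a ∈ Ψ.contElements) :
    Integrable fun t => f t • Ψ.psi (-t) a := by
  refine Integrable.smul_bdd (C := Ψ.bound * ‖a‖) hf ?_ ?_
  · exact ((Ψ.continuous_psi ha).comp continuous_neg).aestronglyMeasurable
  · exact ae_of_all _ fun t => Ψ.norm_psi_le _ _

theorem norm_action_le {f : Rd d → ℂ} (hf : Integrable f) (a : A) :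
    ‖Ψ.action f a‖ ≤ Ψ.bound * (∫ t, ‖f t‖) * ‖a‖ := by
  calc ‖Ψ.action f a‖ ≤ ∫ t, ‖f t‖ * (Ψ.bound * ‖a‖) := by
        refine norm_integral_le_of_norm_le (hf.norm.mul_const _) (ae_of_all _ fun t => ?_)
        rw [norm_smul]
        gcongr
        exact Ψ.norm_psi_le _ _
    _ = _ := by rw [integral_mul_const]; ring

theorem action_add {f : Rd d → ℂ} (hf : Integrable f) {a b : A} (ha : a ∈ Ψ.contElements)
    (hb : b ∈ Ψ.contElements) : Ψ.action f (a + b) = Ψ.action f a + Ψ.action f b := by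
  simp only [action, map_add, smul_add]
  exact integral_add (Ψ.integrable_action hf ha) (Ψ.integrable_action hf hb)

theorem action_smul (f : Rd d → ℂ) (c : ℂ) (a : A) : Ψ.action f (c • a) = c • Ψ.action f a := by
  simp only [action, map_smul, smul_comm _ c]
  exact integral_smul _ _

theorem action_sub {f : Rd d → ℂ} (hf : Integrable f) {a b : A} (ha : a ∈ Ψ.contElements)
    (hb : b ∈ Ψ.contElements) : Ψ.action f (a - b) = Ψ.action f a - Ψ.action f b := by
  simp only [action, map_sub, smul_sub]
  exact integral_sub (Ψ.integrable_action hf ha) (Ψ.integrable_action hf hb)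

theorem psi_action [CompleteSpace A] {f : Rd d → ℂ} (hf : Integrable f) {a : A}
    (ha : a ∈ Ψ.contElements) (s : Rd d) : Ψ.psi s (Ψ.action f a) = Ψ.action f (Ψ.psi s a) := by
  rw [← psiCLM_apply, action, ← ContinuousLinearMap.integral_comp_comm _
    (Ψ.integrable_action hf ha), action]
  simp [Ψ.psi_psi, add_comm]

theorem action_mem [CompleteSpace A] {f : Rd d → ℂ} (hf : Integrable f) {a : A}
    (ha : a ∈ Ψ.contElements) : Ψ.action f a ∈ Ψ.contElements := by
  refine squeeze_zero (fun _ => norm_nonneg _) (fun t => ?_)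
    (by simpa using Tendsto.const_mul (Ψ.bound * ∫ t, ‖f t‖) ha)
  rw [Ψ.psi_action hf ha, ← Ψ.action_sub hf (Ψ.psi_mem_contElements ha t) ha]
  exact Ψ.norm_action_le hf _

theorem diff_action [CompleteSpace A] {f : Rd d → ℂ} (hf : Integrable f) {a : A}
    (ha : a ∈ Ψ.contElements) (s : Rd d) : Ψ.diff s (Ψ.action f a) = Ψ.action f (Ψ.diff s a) := by
  rw [diff, diff, Ψ.psi_action hf ha, Ψ.action_sub hf (Ψ.psi_mem_contElements ha s) ha]

/-- The operator `m(D) : a ↦ (𝓕⁻¹ m) * a` with symbol `m`. -/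
noncomputable def mult (m : Rd d → ℂ) (a : A) : A := Ψ.action (𝓕⁻ m) a

/-- The bound `M ‖𝓕⁻¹ m‖₁` for the norm of `m(D)`; it is invariant under dilations of `m`. -/
noncomputable def symbolNorm (m : Rd d → ℂ) : ℝ := Ψ.bound * ∫ t, ‖𝓕⁻ m t‖

theorem symbolNorm_nonneg (m : Rd d → ℂ) : 0 ≤ Ψ.symbolNorm m :=
  mul_nonneg Ψ.bound_nonneg (integral_nonneg fun _ => norm_nonneg _)

theorem symbolNorm_comp_smul (m : Rd d → ℂ) {c : ℝ} (hc : 0 < c) :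
    Ψ.symbolNorm (fun ξ => m (c⁻¹ • ξ)) = Ψ.symbolNorm m := by
  unfold symbolNorm
  congr 1
  simp only [kernel_comp_smul m hc, norm_mul]
  rw [integral_const_mul, Measure.integral_comp_smul volume (fun t => ‖𝓕⁻ m t‖) c]
  have : 0 < c ^ d := by positivity
  simp only [finrank_euclideanSpace, Fintype.card_fin, abs_inv, abs_of_pos this, smul_eq_mul,
    Complex.norm_real, Real.norm_eq_abs]
  field_simp

variable {m m₁ m₂ : Rd d → ℂ} {a b : A}

theorem norm_mult_le (hm : IsMultiplier m) (a : A) : ‖Ψ.mult m a‖ ≤ Ψ.symbolNorm m * ‖a‖ :=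
  Ψ.norm_action_le hm.integrable_kernel a

theorem mult_add (hm : IsMultiplier m) (ha : a ∈ Ψ.contElements) (hb : b ∈ Ψ.contElements) :
    Ψ.mult m (a + b) = Ψ.mult m a + Ψ.mult m b :=
  Ψ.action_add hm.integrable_kernel ha hb

theorem mult_sub (hm : IsMultiplier m) (ha : a ∈ Ψ.contElements) (hb : b ∈ Ψ.contElements) :
    Ψ.mult m (a - b) = Ψ.mult m a - Ψ.mult m b :=
  Ψ.action_sub hm.integrable_kernel ha hb

theorem mult_smul (m : Rd d → ℂ) (c : ℂ) (a : A) : Ψ.mult m (c • a) = c • Ψ.mult m a :=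
  Ψ.action_smul _ c a

theorem mult_symbol_add (h₁ : IsMultiplier m₁) (h₂ : IsMultiplier m₂) (ha : a ∈ Ψ.contElements) :
    Ψ.mult (fun ξ => m₁ ξ + m₂ ξ) a = Ψ.mult m₁ a + Ψ.mult m₂ a := by
  have h : 𝓕⁻ (fun ξ => m₁ ξ + m₂ ξ) = fun t => 𝓕⁻ m₁ t + 𝓕⁻ m₂ t := by
    have : (h₁.add h₂).schwartz = h₁.schwartz + h₂.schwartz := rfl
    rw [← (h₁.add h₂).coe_fourierInv_schwartz, ← h₁.coe_fourierInv_schwartz,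
      ← h₂.coe_fourierInv_schwartz, this, FourierTransform.fourierInv_add]
    rfl
  simp only [mult, action, h, add_smul]
  exact integral_add (Ψ.integrable_action h₁.integrable_kernel ha)
    (Ψ.integrable_action h₂.integrable_kernel ha)

theorem mult_symbol_smul (c : ℂ) (m : Rd d → ℂ) (a : A) :
    Ψ.mult (fun ξ => c * m ξ) a = c • Ψ.mult m a := by
  have h : 𝓕⁻ (fun ξ => c * m ξ) = fun t => c * 𝓕⁻ m t := by
    funext t
    rw [Real.fourierInv_eq', Real.fourierInv_eq', ← integral_const_mul]
    congr 1
    funext ξ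
    simp only [smul_eq_mul]
    ring
  simp only [mult, action, h, mul_smul]
  exact integral_smul _ _

theorem mult_symbol_sum {ι : Type*} {s : Finset ι} {f : ι → Rd d → ℂ}
    (hf : ∀ i ∈ s, IsMultiplier (f i)) (ha : a ∈ Ψ.contElements) :
    Ψ.mult (fun ξ => ∑ i ∈ s, f i ξ) a = ∑ i ∈ s, Ψ.mult (f i) a := by
  classical
  induction s using Finset.induction_on with
  | empty => simpa using Ψ.mult_symbol_smul 0 (fun _ => 0) a
  | insert i s hi ih =>
    have h1 : ∀ k ∈ s, IsMultiplier (f k) := fun k hk => hf k (by simp [hk])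
    simp only [Finset.sum_insert hi]
    rw [Ψ.mult_symbol_add (hf i (by simp)) (IsMultiplier.sum h1) ha, ih h1]

theorem hasDerivAt_orbit_of_zero {j : Fin d} (h : HasDerivAt (Ψ.orbit j a) b 0) (x : ℝ) :
    HasDerivAt (Ψ.orbit j a) (Ψ.psi (x • EuclideanSpace.single j (1 : ℝ)) b) x := by
  have h1 : HasDerivAt (fun y : ℝ => Ψ.orbit j a (y - x)) b x := by
    have := HasDerivAt.comp_sub_const (f := Ψ.orbit j a) (f' := b) x x (by simpa using h)
    exact this
  have h2 := ((Ψ.psiCLM (x • EuclideanSpace.single j (1 : ℝ))).restrictScalars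
    ℝ).hasFDerivAt.comp_hasDerivAt x h1
  refine h2.congr_of_eventuallyEq (Eventually.of_forall fun y => ?_)
  simp [orbit, Ψ.psi_psi, ← add_smul]

variable [CompleteSpace A]

theorem mult_mem (hm : IsMultiplier m) (ha : a ∈ Ψ.contElements) :
    Ψ.mult m a ∈ Ψ.contElements :=
  Ψ.action_mem hm.integrable_kernel ha

theorem psi_mult (hm : IsMultiplier m) (ha : a ∈ Ψ.contElements) (s : Rd d) :
    Ψ.psi s (Ψ.mult m a) = ∫ t, 𝓕⁻ m (t + s) • Ψ.psi (-t) a := by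
  rw [mult, Ψ.psi_action hm.integrable_kernel ha, action,
    ← integral_add_right_eq_self (μ := volume) _ s]
  simp [Ψ.psi_psi]

theorem psi_mult_eq (hm : IsMultiplier m) (ha : a ∈ Ψ.contElements) (s : Rd d) :
    Ψ.psi s (Ψ.mult m a) = Ψ.mult (fun ξ => character s ξ * m ξ) a := by
  rw [Ψ.psi_mult hm ha, mult, action]
  simp only [kernel_character_mul]

theorem diff_mult (hm : IsMultiplier m) (ha : a ∈ Ψ.contElements) (s : Rd d) :
    Ψ.diff s (Ψ.mult m a) = Ψ.mult (fun ξ => (character s ξ - 1) * m ξ) a := by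
  have h1 : IsMultiplier fun ξ => (character s ξ - 1) * m ξ :=
    hm.mul_left ((contDiff_character s).sub contDiff_const)
  rw [diff, Ψ.psi_mult_eq hm ha, sub_eq_iff_eq_add, ← Ψ.mult_symbol_add h1 hm ha]
  congr 1
  funext ξ
  ring

/-- The operators `m(D)` are multiplicative in the symbol. -/
theorem mult_mul (h₁ : IsMultiplier m₁) (h₂ : IsMultiplier m₂) (ha : a ∈ Ψ.contElements) :
    Ψ.mult (fun ξ => m₁ ξ * m₂ ξ) a = Ψ.mult m₁ (Ψ.mult m₂ a) := by
  have hint : Integrable (Function.uncurry fun s t : Rd d =>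
      𝓕⁻ m₁ s • (𝓕⁻ m₂ (t - s) • Ψ.psi (-t) a)) (volume.prod volume) := by
    have h := h₁.integrable_kernel.convolution_integrand (ContinuousLinearMap.mul ℂ ℂ)
      h₂.integrable_kernel
    have h' := h.swap
    have h2 : Integrable (fun p : Rd d × Rd d =>
        (𝓕⁻ m₁ p.1 * 𝓕⁻ m₂ (p.2 - p.1)) • Ψ.psi (-p.2) a) (volume.prod volume) := by
      refine Integrable.smul_bdd (C := Ψ.bound * ‖a‖) h' ?_ ?_
      · exact ((Ψ.continuous_psi ha).comp (continuous_neg.comp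
          continuous_snd)).aestronglyMeasurable
      · exact ae_of_all _ fun t => Ψ.norm_psi_le _ _
    simpa only [Function.uncurry_def, smul_smul] using h2
  calc Ψ.mult (fun ξ => m₁ ξ * m₂ ξ) a
      = ∫ t, ∫ s, 𝓕⁻ m₁ s • (𝓕⁻ m₂ (t - s) • Ψ.psi (-t) a) := by
        rw [mult, action]
        congr 1
        funext t
        rw [h₁.kernel_mul h₂, ← integral_smul_const]
        simp only [smul_smul]
    _ = ∫ s, ∫ t, 𝓕⁻ m₁ s • (𝓕⁻ m₂ (t - s) • Ψ.psi (-t) a) := (integral_integral_swap hint).symm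
    _ = Ψ.mult m₁ (Ψ.mult m₂ a) := by
        conv_rhs => rw [mult, action]
        congr 1
        funext s
        rw [integral_smul, Ψ.psi_mult h₂ ha]
        simp only [sub_eq_add_neg]

/-- `δ_j m(D) = (2πi ξ_j m)(D)`. -/
theorem hasDerivAt_orbit_mult (hm : IsMultiplier m) (ha : a ∈ Ψ.contElements) (j : Fin d) :
    HasDerivAt (Ψ.orbit j (Ψ.mult m a)) (Ψ.mult (fun ξ => genSymbol j ξ * m ξ) a) 0 := by
  have hm' := hm.mul_left (contDiff_genSymbol j)
  obtain ⟨g, hg, hgb⟩ := hm'.exists_kernel_bound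
  have hcont : Continuous fun t => Ψ.psi (-t) a := (Ψ.continuous_psi ha).comp continuous_neg
  have key := hasDerivAt_integral_of_dominated_loc_of_deriv_le (μ := (volume : Measure (Rd d)))
    (F := fun (h : ℝ) t => 𝓕⁻ m (t + h • EuclideanSpace.single j (1 : ℝ)) • Ψ.psi (-t) a)
    (F' := fun (h : ℝ) t =>
      𝓕⁻ (fun ξ => genSymbol j ξ * m ξ) (t + h • EuclideanSpace.single j (1 : ℝ)) • Ψ.psi (-t) a)
    (bound := fun t => g t * (Ψ.bound * ‖a‖)) (x₀ := 0) (Metric.ball_mem_nhds 0 one_pos)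
    (Eventually.of_forall fun h => ?_) ?_ ?_ ?_ (hg.mul_const _) ?_
  · have h2 := key.2
    simp only [zero_smul, add_zero] at h2
    refine HasDerivAt.congr_of_eventuallyEq (f := fun h : ℝ => ∫ t,
      𝓕⁻ m (t + h • EuclideanSpace.single j (1 : ℝ)) • Ψ.psi (-t) a) h2
      (Eventually.of_forall fun h => ?_)
    exact Ψ.psi_mult hm ha _
  · exact ((hm.continuous_kernel.comp (continuous_add_const _)).smul hcont).aestronglyMeasurable
  · simpa using Ψ.integrable_action hm.integrable_kernel ha
  · exact ((hm'.continuous_kernel.comp (continuous_add_const _)).smul hcont).aestronglyMeasurable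
  · refine ae_of_all _ fun t h hh => ?_
    rw [norm_smul]
    refine mul_le_mul (hgb t _ ?_) (Ψ.norm_psi_le _ _) (norm_nonneg _)
      ((norm_nonneg _).trans (hgb t 0 (by simp)))
    rw [norm_smul]
    simpa using (mem_ball_zero_iff.1 hh).le
  · exact ae_of_all _ fun t h _ => (hm.hasDerivAt_kernel j t h).smul_const _

/-- `δ_j m(D) a = m(D) δ_j a` for `a` in the domain of `δ_j`. -/
theorem hasDerivAt_orbit_mult_of_hasDerivAt (hm : IsMultiplier m) {j : Fin d}
    (ha : a ∈ Ψ.contElements) (hb : b ∈ Ψ.contElements) (h : HasDerivAt (Ψ.orbit j a) b 0) :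
    HasDerivAt (Ψ.orbit j (Ψ.mult m a)) (Ψ.mult m b) 0 := by
  rw [hasDerivAt_orbit_iff, tendsto_iff_norm_sub_tendsto_zero] at h ⊢
  refine squeeze_zero (fun _ => norm_nonneg _) (fun x => ?_)
    (by simpa using h.const_mul (Ψ.symbolNorm m))
  set s := x • EuclideanSpace.single j (1 : ℝ)
  have hd := Ψ.diff_mem_contElements ha s
  have h1 : Ψ.psi s (Ψ.mult m a) - Ψ.mult m a = Ψ.mult m (Ψ.diff s a) :=
    Ψ.diff_action hm.integrable_kernel ha s
  have h2 : ∀ c : A, x⁻¹ • c = ((x⁻¹ : ℝ) : ℂ) • c := fun c => (Complex.coe_smul _ _).symm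
  rw [h1, h2, ← mult_smul, ← Ψ.mult_sub hm (Ψ.contSubmodule.smul_mem _ hd) hb]
  refine (Ψ.norm_mult_le hm _).trans_eq ?_
  rw [← h2]
  rfl

/-- The operators `m(D / N)` converge strongly to multiplication by `m(0)` on `C(A)`. -/
theorem tendsto_mult_comp_smul (hm : IsMultiplier m) (ha : a ∈ Ψ.contElements) {c : ℕ → ℝ}
    (hc : ∀ n, 0 < c n) (hlim : Tendsto c atTop atTop) :
    Tendsto (fun n => Ψ.mult (fun ξ => m ((c n)⁻¹ • ξ)) a) atTop (𝓝 (m 0 • a)) := by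
  have h1 : ∀ n, Ψ.mult (fun ξ => m ((c n)⁻¹ • ξ)) a =
      ∫ t, 𝓕⁻ m t • Ψ.psi (-((c n)⁻¹ • t)) a := fun n => by
    have h2 := Measure.integral_comp_smul (volume : Measure (Rd d))
      (fun t => 𝓕⁻ m t • Ψ.psi (-((c n)⁻¹ • t)) a) (c n)
    have h3 : 0 < c n ^ d := pow_pos (hc n) d
    have h4 : |(c n ^ Module.finrank ℝ (Rd d))⁻¹| = (c n ^ d)⁻¹ := by
      simp [abs_of_pos (hc n)]
    rw [h4, eq_inv_smul_iff₀ h3.ne', ← integral_smul] at h2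
    rw [← h2, mult, action]
    congr 1
    funext t
    rw [kernel_comp_smul m (hc n), mul_smul, Complex.coe_smul, smul_smul (c n)⁻¹,
      inv_mul_cancel₀ (hc n).ne', one_smul]
  simp only [h1]
  rw [← hm.integral_kernel, ← integral_smul_const]
  refine tendsto_integral_of_dominated_convergence (fun t => ‖𝓕⁻ m t‖ * (Ψ.bound * ‖a‖))
    (fun n => ?_) (hm.integrable_kernel.norm.mul_const _) (fun n => ae_of_all _ fun t => ?_)
    (ae_of_all _ fun t => ?_)
  · exact (hm.continuous_kernel.smul ((Ψ.continuous_psi ha).comp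
      (continuous_const_smul _).neg)).aestronglyMeasurable
  · rw [norm_smul]
    gcongr
    exact Ψ.norm_psi_le _ _
  · have h2 : Tendsto (fun n => -((c n)⁻¹ • t)) atTop (𝓝 0) := by
      simpa using ((tendsto_inv_atTop_zero.comp hlim).smul_const t).neg
    have h3 := ((Ψ.continuous_psi ha).tendsto 0).comp h2
    rw [Ψ.psi_zero] at h3
    exact h3.const_smul _

end AutomorphismGroup

end BanachSmooth

/-! ### Dyadic partitions of unity -/

namespace BanachSmooth

open scoped ContDiff

variable {d : ℕ}

/-- The smoothness, support and summation properties of a dyadic partition of unity. -/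
theorem IsDyadicPartition.exists_multipliers {φ : ℕ → Rd d → ℝ} (hφ : IsDyadicPartition φ) :
    (∃ ψ : Rd d → ℂ, IsMultiplier ψ ∧ tsupport ψ ⊆ {ξ | 2⁻¹ ≤ ‖ξ‖ ∧ ‖ξ‖ ≤ 2} ∧
      ∀ (k : ℕ) (ξ : Rd d), (φ (k + 1) ξ : ℂ) = ψ (((2 : ℝ) ^ k)⁻¹ • ξ)) ∧
    IsMultiplier (fun ξ => (φ 0 ξ : ℂ)) ∧
    (∀ ξ : Rd d, ‖ξ‖ < 2⁻¹ → φ 0 ξ = 1) ∧ (∀ ξ : Rd d, 1 < ‖ξ‖ → φ 0 ξ = 0) ∧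
    ∀ (N : ℕ) (ξ : Rd d), ∑ n ∈ Finset.range (N + 1), φ n ξ = φ 0 (((2 : ℝ) ^ N)⁻¹ • ξ) := by
  obtain ⟨ψ, hsupp, -, hsum, hsucc, hzero⟩ := hφ
  have hnorm : ∀ (k : ℤ) (ξ : Rd d), ‖(2 : ℝ) ^ k • ξ‖ = (2 : ℝ) ^ k * ‖ξ‖ := fun k ξ => by
    rw [norm_smul, Real.norm_of_nonneg (by positivity)]
  have hψ : ∀ ξ : Rd d, ‖ξ‖ < 2⁻¹ ∨ 2 < ‖ξ‖ → ψ ξ = 0 := fun ξ h => by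
    refine image_eq_zero_of_notMem_tsupport fun hmem => ?_
    have := hsupp hmem
    rcases h with h | h
    · exact absurd this.1 (not_le.2 h)
    · exact absurd this.2 (not_le.2 h)
  have hsmall : ∀ (k n : ℕ) (ξ : Rd d), ‖ξ‖ < 2⁻¹ * 2 ^ n → n ≤ k →
      ψ ((2 : ℝ) ^ (-(k : ℤ)) • ξ) = 0 := fun k n ξ hξ hk => by
    refine hψ _ (Or.inl ?_)
    rw [hnorm, zpow_neg, zpow_natCast, inv_mul_lt_iff₀ (by positivity), mul_comm]
    exact hξ.trans_le (by gcongr; norm_num)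
  have hsummable : ∀ ξ : Rd d, Summable fun k : ℕ => ψ ((2 : ℝ) ^ (-(k : ℤ)) • ξ) := fun ξ => by
    rcases eq_or_ne ξ 0 with rfl | h
    · simp only [smul_zero]
      rw [hψ 0 (by simp)]
      exact summable_zero
    · exact (hsum ξ h).summable.comp_injective (i := fun k : ℕ => (k : ℤ)) Nat.cast_injective
  have hφ1 : ∀ ξ : Rd d, ‖ξ‖ < 2⁻¹ → φ 0 ξ = 1 := fun ξ h => by
    rw [hzero]
    simp only [fun k : ℕ => hsmall k 0 ξ (by simpa using h) (Nat.zero_le k), tsum_zero, sub_zero]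
  have hφ0 : ∀ ξ : Rd d, 1 < ‖ξ‖ → φ 0 ξ = 0 := fun ξ h => by
    -- for `‖ξ‖ > 1` the terms with negative index vanish, so the others add up to `1`
    have h1 := hsum ξ (norm_pos_iff.1 (one_pos.trans h))
    rw [← Function.Injective.hasSum_iff (g := fun k : ℕ => (k : ℤ)) Nat.cast_injective] at h1
    · rw [hzero, sub_eq_zero]
      exact h1.tsum_eq.symm
    · intro k hk
      have hk0 : k < 0 := by
        by_contra hcon
        exact hk ⟨k.toNat, Int.toNat_of_nonneg (not_lt.1 hcon)⟩
      refine hψ _ (Or.inr ?_)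
      rw [hnorm]
      have h2 : (2 : ℝ) ^ (1 : ℤ) ≤ 2 ^ (-k) := zpow_le_zpow_right₀ (by norm_num) (by omega)
      rw [zpow_one] at h2
      nlinarith
  have hloc : ∀ ξ : Rd d, ‖ξ‖ < 2 → φ 0 ξ = 1 - (ψ ξ + ψ ((2 : ℝ)⁻¹ • ξ)) := fun ξ h => by
    rw [hzero, tsum_eq_sum (s := Finset.range 2)]
    · simp [Finset.sum_range_succ]
    · intro k hk
      exact hsmall k 2 ξ (by norm_num; exact h) (not_lt.1 (Finset.mem_range.not.1 hk))
  have hsmooth : ContDiff ℝ ∞ (φ 0) := by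
    refine contDiff_iff_contDiffAt.2 fun ξ => ?_
    -- the series defining `φ₀` has two terms for `‖ξ‖ < 2`, and `φ₀` vanishes for `‖ξ‖ > 1`
    rcases lt_or_ge ‖ξ‖ 2 with h | h
    · have h1 : ContDiffAt ℝ ∞ (fun ξ => 1 - (ψ ξ + ψ ((2 : ℝ)⁻¹ • ξ))) ξ :=
        (contDiff_const.sub ((ψ.smooth ⊤).add
          ((ψ.smooth ⊤).comp (contDiff_const_smul _)))).contDiffAt
      refine h1.congr_of_eventuallyEq ?_
      filter_upwards [(continuous_norm.tendsto ξ).eventually (gt_mem_nhds h)] with x hx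
      exact hloc x hx
    · refine (contDiffAt_const (c := (0 : ℝ))).congr_of_eventuallyEq ?_
      filter_upwards [(continuous_norm.tendsto ξ).eventually
        (lt_mem_nhds (show 1 < ‖ξ‖ by linarith))] with x hx
      exact hφ0 x hx
  have hψt : tsupport (fun ξ => (ψ ξ : ℂ)) ⊆ {ξ | 2⁻¹ ≤ ‖ξ‖ ∧ ‖ξ‖ ≤ 2} := by
    refine subset_trans (closure_mono ?_) hsupp
    intro ξ hξ
    simpa using hξ
  refine ⟨⟨fun ξ => (ψ ξ : ℂ), ⟨Complex.ofRealCLM.contDiff.comp (ψ.smooth ⊤), ?_⟩, hψt, ?_⟩,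
    ⟨Complex.ofRealCLM.contDiff.comp hsmooth, ?_⟩, hφ1, hφ0, ?_⟩
  · refine HasCompactSupport.of_support_subset_isCompact (isCompact_closedBall (0 : Rd d) 2) ?_
    intro ξ hξ
    simpa using (hψt (subset_tsupport _ hξ)).2
  · intro k ξ
    rw [hsucc, zpow_neg, zpow_natCast]
  · refine HasCompactSupport.of_support_subset_isCompact (isCompact_closedBall (0 : Rd d) 1) ?_
    intro ξ hξ
    by_contra hcon
    exact hξ (by simpa using hφ0 ξ (by simpa using hcon))
  · intro N
    induction N with
    | zero => simp
    | succ N ih =>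
      intro ξ
      rw [Finset.sum_range_succ, ih, hsucc, hzero, hzero, (hsummable _).tsum_eq_zero_add]
      have h1 : ∀ k : ℕ, (2 : ℝ) ^ (-((k + 1 : ℕ) : ℤ)) • ((2 : ℝ) ^ N)⁻¹ • ξ =
          (2 : ℝ) ^ (-(k : ℤ)) • ((2 : ℝ) ^ (N + 1))⁻¹ • ξ := fun k => by
        simp only [smul_smul, zpow_neg, zpow_natCast, ← mul_inv, pow_succ]
        ring_nf
      simp only [h1]
      simp only [zpow_neg, zpow_natCast, Nat.cast_zero, neg_zero, zpow_zero, one_smul]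
      ring

end BanachSmooth

/-! ### Symbols of differences and derivatives -/

namespace BanachSmooth

open scoped ContDiff

variable {d : ℕ}

/-- The symbol `∏ 2πi ξ_j`, taken over the letters `j` of the word `w`, of the operator `δ_w`. -/
noncomputable def wordSymbol (w : List (Fin d)) (ξ : Rd d) : ℂ :=
  (w.map fun j => genSymbol j ξ).prod

theorem wordSymbol_cons (j : Fin d) (w : List (Fin d)) (ξ : Rd d) :
    wordSymbol (j :: w) ξ = genSymbol j ξ * wordSymbol w ξ := by simp [wordSymbol]

theorem contDiff_wordSymbol (w : List (Fin d)) : ContDiff ℝ ∞ (wordSymbol w) := by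
  induction w with
  | nil => simpa [wordSymbol, Function.comp_def] using! contDiff_const
  | cons j w ih =>
    have : wordSymbol (j :: w) = fun ξ => genSymbol j ξ * wordSymbol w ξ :=
      funext (wordSymbol_cons j w)
    rw [this]
    exact (contDiff_genSymbol j).mul ih

theorem wordSymbol_smul (w : List (Fin d)) (c : ℝ) (ξ : Rd d) :
    wordSymbol w (c • ξ) = (c : ℂ) ^ w.length * wordSymbol w ξ := by
  induction w with
  | nil => simp [wordSymbol]
  | cons j w ih =>
    rw [wordSymbol_cons, ih, wordSymbol_cons, List.length_cons, pow_succ, genSymbol, genSymbol]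
    simp only [PiLp.smul_apply, smul_eq_mul, Complex.ofReal_mul]
    ring

theorem character_smul (s ξ : Rd d) (c : ℝ) : character s (c • ξ) = character (c • s) ξ := by
  simp [character, inner_smul_left, inner_smul_right]

theorem length_indexWord (α : Fin d → ℕ) : (indexWord α).length = ∑ j, α j := by
  simp [indexWord, List.length_flatten, List.map_ofFn, List.sum_ofFn]

theorem indexWord_single (j : Fin d) (k : ℕ) :
    indexWord (Pi.single j k : Fin d → ℕ) = List.replicate k j := by
  refine List.eq_replicate_iff.2 ⟨by simp [length_indexWord], fun b hb => ?_⟩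
  simp only [indexWord, List.mem_flatten, List.mem_ofFn] at hb
  obtain ⟨l, ⟨i, rfl⟩, hb⟩ := hb
  obtain ⟨h1, rfl⟩ := List.mem_replicate.1 hb
  by_contra hne
  exact h1 (by rw [Pi.single_apply, if_neg hne])

theorem l1norm_smul_single (j : Fin d) (c : ℝ) :
    l1norm (c • EuclideanSpace.single j (1 : ℝ)) = |c| := by
  simp only [l1norm, PiLp.smul_apply, PiLp.single_apply, smul_eq_mul]
  rw [Finset.sum_eq_single j]
  · simp
  · intro i _ hi
    simp [hi]
  · simp

theorem l1norm_pos {t : Rd d} (ht : t ≠ 0) : 0 < l1norm t := by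
  obtain ⟨i, hi⟩ : ∃ i, t i ≠ 0 := by
    by_contra! hcon
    exact ht (by ext i; exact hcon i)
  exact Finset.sum_pos' (fun _ _ => abs_nonneg _) ⟨i, Finset.mem_univ i, abs_pos.2 hi⟩

/-- The symbol of `Δ_s² δ_j^k` with `s = e_j / 4`. For `0 < ‖ξ‖ ≤ 2` it vanishes only if
`ξ_j = 0`. -/
noncomputable def diffSymbol (k : ℕ) (j : Fin d) (ξ : Rd d) : ℂ :=
  wordSymbol (List.replicate k j) ξ *
    (character ((4⁻¹ : ℝ) • EuclideanSpace.single j (1 : ℝ)) ξ - 1) ^ 2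

theorem contDiff_diffSymbol (k : ℕ) (j : Fin d) : ContDiff ℝ ∞ (diffSymbol k j) :=
  (contDiff_wordSymbol _).mul (((contDiff_character _).sub contDiff_const).pow 2)

theorem diffSymbol_ne_zero (k : ℕ) {j : Fin d} {ξ : Rd d} (hj : ξ j ≠ 0) (hξ : ‖ξ‖ ≤ 2) :
    diffSymbol k j ξ ≠ 0 := by
  have hπ : (Real.pi : ℂ) ≠ 0 := by simp [Real.pi_ne_zero]
  refine mul_ne_zero ?_ (pow_ne_zero 2 (sub_ne_zero.2 fun h => ?_))
  · simp [wordSymbol, genSymbol, hj, hπ]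
  · -- `e^{2πi ξ_j / 4} = 1` forces `ξ_j ∈ 4ℤ`, hence `ξ_j = 0`
    rw [character, Complex.exp_eq_one_iff] at h
    obtain ⟨n, hn⟩ := h
    have h1 : ξ j = 4 * n := by
      have h2 : ((ξ j : ℝ) : ℂ) = ((4 * (n : ℝ) : ℝ) : ℂ) := by
        simp only [inner_smul_right, EuclideanSpace.inner_single_right] at hn
        simp at hn
        have h3 : (2 * Real.pi * Complex.I : ℂ) ≠ 0 := by simp [hπ]
        push_cast
        have h4 : (2 * Real.pi * Complex.I : ℂ) * (ξ j : ℂ) =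
            2 * Real.pi * Complex.I * (4 * n) := by
          linear_combination 4 * hn
        exact mul_left_cancel₀ h3 h4
      exact Complex.ofReal_injective h2
    have h2 : |ξ j| ≤ 2 := (PiLp.norm_apply_le ξ j).trans hξ
    rw [h1] at h2 hj
    have hn0 : n ≠ 0 := fun h => hj (by simp [h])
    have h3 : (1 : ℝ) ≤ |(n : ℝ)| := by exact_mod_cast Int.one_le_abs hn0
    rw [abs_mul] at h2
    norm_num at h2
    linarith

/-- A multiplier supported in the annulus `1/2 ≤ ‖ξ‖ ≤ 2` is a combination, with multipliers as
coefficients, of the symbols of `Δ_s² δ_j^k`, because these have no common zero there. -/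
theorem IsMultiplier.exists_eq_sum_diffSymbol {ψ : Rd d → ℂ} (hψ : IsMultiplier ψ)
    (hsupp : tsupport ψ ⊆ {ξ | 2⁻¹ ≤ ‖ξ‖ ∧ ‖ξ‖ ≤ 2}) (k : ℕ) :
    ∃ χ : Fin d → Rd d → ℂ, (∀ j, IsMultiplier (χ j)) ∧
      ∀ ξ, ψ ξ = ∑ j, diffSymbol k j ξ * χ j ξ := by
  set D : Rd d → ℂ := fun ξ => ∑ i, diffSymbol k i ξ * (starRingEnd ℂ) (diffSymbol k i ξ) with hD
  have hconj : ∀ j, ContDiff ℝ ∞ fun ξ : Rd d => (starRingEnd ℂ) (diffSymbol k j ξ) := fun j =>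
    Complex.conjCLE.contDiff.comp (contDiff_diffSymbol k j)
  have hDs : ContDiff ℝ ∞ D :=
    ContDiff.sum fun i _ => (contDiff_diffSymbol k i).mul (hconj i)
  have hD0 : ∀ ξ ∈ tsupport ψ, D ξ ≠ 0 := fun ξ hξ => by
    have h := hsupp hξ
    have hne : ξ ≠ 0 := by
      rintro rfl
      have := h.1
      norm_num at this
    obtain ⟨i, hi⟩ : ∃ i, ξ i ≠ 0 := by
      by_contra! hcon
      exact hne (by ext i; exact hcon i)
    have h1 : D ξ = ((∑ i, Complex.normSq (diffSymbol k i ξ) : ℝ) : ℂ) := by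
      simp only [hD, Complex.mul_conj, Complex.ofReal_sum]
    rw [h1, Complex.ofReal_ne_zero]
    have h2 : 0 < ∑ i, Complex.normSq (diffSymbol k i ξ) :=
      Finset.sum_pos' (fun _ _ => Complex.normSq_nonneg _)
        ⟨i, Finset.mem_univ i, Complex.normSq_pos.2 (diffSymbol_ne_zero k hi h.2)⟩
    exact h2.ne'
  have hquot : IsMultiplier fun ξ => (D ξ)⁻¹ * ψ ξ := by
    refine ⟨contDiff_iff_contDiffAt.2 fun ξ => ?_, hψ.compact.mul_left⟩
    by_cases hξ : ξ ∈ tsupport ψ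
    · exact (hDs.contDiffAt.inv (hD0 ξ hξ)).mul hψ.smooth.contDiffAt
    · refine (contDiffAt_const (c := (0 : ℂ))).congr_of_eventuallyEq ?_
      filter_upwards [(isClosed_tsupport ψ).isOpen_compl.mem_nhds hξ] with x hx
      rw [image_eq_zero_of_notMem_tsupport hx, mul_zero]
  refine ⟨fun j ξ => (starRingEnd ℂ) (diffSymbol k j ξ) * ((D ξ)⁻¹ * ψ ξ),
    fun j => hquot.mul_left (hconj j), fun ξ => ?_⟩
  simp only [← mul_assoc, ← Finset.sum_mul]
  by_cases hξ : ξ ∈ tsupport ψ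
  · change ψ ξ = D ξ * (D ξ)⁻¹ * ψ ξ
    rw [mul_inv_cancel₀ (hD0 ξ hξ), one_mul]
  · rw [image_eq_zero_of_notMem_tsupport hξ, mul_zero]

namespace AutomorphismGroup

variable {A : Type*} [NormedRing A] [NormedAlgebra ℂ A] (Ψ : AutomorphismGroup d A)
  {m : Rd d → ℂ} {a : A}

theorem genWord_mem_contElements {w : List (Fin d)} (ha : a ∈ Ψ.genWordDomain w) :
    Ψ.genWord w a ∈ Ψ.contElements := by
  cases w with
  | nil => exact ha
  | cons j w => exact ha.2.2

theorem genWordDomain_subset (w : List (Fin d)) : Ψ.genWordDomain w ⊆ Ψ.contElements := by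
  induction w with
  | nil => exact subset_rfl
  | cons j w ih => exact fun a ha => ih ha.1

variable [CompleteSpace A]

/-- `m(D) δ_w a = (W m)(D) a` for `a` in the domain of `δ_w`, where `W` is the symbol of `δ_w`. -/
theorem mult_genWord {w : List (Fin d)} (hm : IsMultiplier m) (ha : a ∈ Ψ.genWordDomain w) :
    Ψ.mult m (Ψ.genWord w a) = Ψ.mult (fun ξ => wordSymbol w ξ * m ξ) a := by
  induction w generalizing m with
  | nil => simp [genWord, wordSymbol]
  | cons j w ih =>
    have hb := Ψ.genWord_mem_contElements ha.1
    have h1 := Ψ.hasDerivAt_orbit_mult_of_hasDerivAt hm hb ha.2.2 ha.2.1.hasDerivAt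
    have h2 := Ψ.hasDerivAt_orbit_mult hm hb j
    rw [genWord, h1.unique h2, ih (hm.mul_left (contDiff_genSymbol j)) ha.1]
    congr 1
    funext ξ
    rw [wordSymbol_cons]
    ring

theorem mult_character_sub_one_sq (hm : IsMultiplier m) (ha : a ∈ Ψ.contElements) (s : Rd d) :
    Ψ.mult (fun ξ => (character s ξ - 1) ^ 2 * m ξ) a = Ψ.mult m (Ψ.diff s (Ψ.diff s a)) := by
  have h1 := hm.mul_left ((contDiff_character s).sub (contDiff_const (c := (1 : ℂ))))
  rw [mult, mult, ← Ψ.diff_action hm.integrable_kernel (Ψ.diff_mem_contElements ha s),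
    ← Ψ.diff_action hm.integrable_kernel ha, ← mult, ← mult, Ψ.diff_mult hm ha, Ψ.diff_mult h1 ha]
  congr 1
  funext ξ
  ring

/-- The part of `a` with frequencies of size `c` is bounded by `c^{-k}` times the second differences
of step `1 / (4c)` of the pure `k`-th derivatives of `a`. -/
theorem exists_norm_mult_le_sum_diff {ψ : Rd d → ℂ} (hψ : IsMultiplier ψ)
    (hsupp : tsupport ψ ⊆ {ξ | 2⁻¹ ≤ ‖ξ‖ ∧ ‖ξ‖ ≤ 2}) (k : ℕ) :
    ∃ C : Fin d → ℝ, (∀ j, 0 ≤ C j) ∧ ∀ c : ℝ, 0 < c → ∀ a ∈ Ψ.Ck k,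
      ‖Ψ.mult (fun ξ => ψ (c⁻¹ • ξ)) a‖ ≤ (c ^ k)⁻¹ * ∑ j, C j *
        ‖Ψ.diff (c⁻¹ • (4⁻¹ : ℝ) • EuclideanSpace.single j (1 : ℝ))
          (Ψ.diff (c⁻¹ • (4⁻¹ : ℝ) • EuclideanSpace.single j (1 : ℝ))
            (Ψ.genWord (List.replicate k j) a))‖ := by
  obtain ⟨χ, hχ, hsum⟩ := hψ.exists_eq_sum_diffSymbol hsupp k
  refine ⟨fun j => Ψ.symbolNorm (χ j), fun j => Ψ.symbolNorm_nonneg _, fun c hc a ha => ?_⟩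
  have hdom : ∀ j, a ∈ Ψ.genWordDomain (List.replicate k j) := fun j => by
    rw [← indexWord_single]
    exact ha _ (by simp)
  have hX : ∀ j, IsMultiplier fun ξ => χ j (c⁻¹ • ξ) := fun j =>
    (hχ j).comp_smul (inv_ne_zero hc.ne')
  set s : Fin d → Rd d := fun j => c⁻¹ • (4⁻¹ : ℝ) • EuclideanSpace.single j (1 : ℝ)
  have hY : ∀ j, IsMultiplier fun ξ => (character (s j) ξ - 1) ^ 2 * χ j (c⁻¹ • ξ) := fun j =>
    (hX j).mul_left (((contDiff_character _).sub contDiff_const).pow 2)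
  have hZ : ∀ j, IsMultiplier fun ξ => wordSymbol (List.replicate k j) ξ *
      ((character (s j) ξ - 1) ^ 2 * χ j (c⁻¹ • ξ)) := fun j =>
    (hY j).mul_left (contDiff_wordSymbol _)
  have hexp : (fun ξ => ψ (c⁻¹ • ξ)) = fun ξ => (((c ^ k)⁻¹ : ℝ) : ℂ) *
      ∑ j, wordSymbol (List.replicate k j) ξ *
        ((character (s j) ξ - 1) ^ 2 * χ j (c⁻¹ • ξ)) := by
    funext ξ
    rw [hsum, Finset.mul_sum]
    refine Finset.sum_congr rfl fun j _ => ?_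
    rw [diffSymbol, wordSymbol_smul, character_smul, List.length_replicate]
    push_cast
    rw [inv_pow]
    ring
  have ha0 : a ∈ Ψ.contElements := Ψ.genWordDomain_subset _ (ha 0 (by simp))
  rw [hexp, mult_symbol_smul, Ψ.mult_symbol_sum (fun j _ => hZ j) ha0, norm_smul,
    Complex.norm_real, Real.norm_of_nonneg (by positivity)]
  gcongr
  refine norm_sum_le_of_le _ fun j _ => ?_
  rw [← Ψ.mult_genWord (hY j) (hdom j),
    Ψ.mult_character_sub_one_sq (hX j) (Ψ.genWord_mem_contElements (hdom j))]
  exact (Ψ.norm_mult_le (hX j) _).trans_eq (by rw [Ψ.symbolNorm_comp_smul _ hc])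

end AutomorphismGroup

end BanachSmooth

/-! ### Dyadic expansions -/

namespace BanachSmooth

open scoped ContDiff

/-- A two-sided geometric series centred at `N`. -/
theorem summable_two_sided_geometric {q : ℝ} (h0 : 0 ≤ q) (h1 : q < 1) (N : ℕ) :
    Summable (fun n : ℕ => q ^ (n - N + (N - n))) ∧
      ∑' n : ℕ, q ^ (n - N + (N - n)) ≤ 2 * (1 - q)⁻¹ := by
  have hshift : (fun n : ℕ => q ^ (n + N - N + (N - (n + N)))) = fun n => q ^ n := by
    funext n
    congr 1
    omega
  have hs : Summable (fun n : ℕ => q ^ (n - N + (N - n))) := by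
    rw [← summable_nat_add_iff N, hshift]
    exact summable_geometric_of_lt_one h0 h1
  refine ⟨hs, ?_⟩
  rw [← hs.sum_add_tsum_nat_add N, hshift, tsum_geometric_of_lt_one h0 h1, two_mul]
  gcongr
  rw [← Finset.sum_range_reflect, ← tsum_geometric_of_lt_one h0 h1]
  refine (Finset.sum_le_sum fun n hn => ?_).trans
    ((summable_geometric_of_lt_one h0 h1).sum_le_tsum (Finset.range N) fun _ _ => pow_nonneg h0 _)
  have hn' := Finset.mem_range.1 hn
  exact pow_le_pow_of_le_one h0 h1.le (by omega)

/-- The terms `2^{-nη} min(1, (2ⁿ τ)²)` are at most of order `τ^η`, which is attained for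
`2ⁿ ≈ 1/τ`, and decay geometrically on both sides of this index. -/
theorem exists_two_sided_decay {η τ : ℝ} (h0 : 0 < η) (h1 : η ≤ 1) (hτ : 0 < τ) :
    ∃ N : ℕ, ∀ n : ℕ, ((2 : ℝ) ^ (-η)) ^ n * min 1 ((2 ^ n * τ) ^ 2) ≤
      2 * τ ^ η * ((2 : ℝ) ^ (-η)) ^ (n - N + (N - n)) := by
  set q : ℝ := (2 : ℝ) ^ (-η) with hq
  have hq0 : 0 < q := by positivity
  have hqhalf : 2⁻¹ ≤ q := by
    rw [hq, ← Real.rpow_neg_one]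
    exact Real.rpow_le_rpow_of_exponent_le (by norm_num) (by linarith)
  -- `2^{-N}` is comparable to `τ`, except that `N = 0` if `τ ≥ 1`
  obtain ⟨N, hN1, hN2⟩ : ∃ N : ℕ, (0 < N → 2 ^ N * τ ≤ 1) ∧ q ^ N ≤ 2 * τ ^ η := by
    rcases le_or_gt 1 τ with h | h
    · refine ⟨0, fun h => absurd h (lt_irrefl _), ?_⟩
      have := Real.one_le_rpow h h0.le
      rw [pow_zero]
      linarith
    · obtain ⟨N, hN, hN'⟩ := exists_nat_pow_near (x := τ⁻¹) (y := (2 : ℝ))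
        ((one_le_inv₀ hτ).2 h.le) one_lt_two
      refine ⟨N, fun _ => ?_, ?_⟩
      · rwa [← le_div_iff₀ hτ, one_div]
      · have h2 : 1 < 2 ^ (N + 1) * τ := by rwa [inv_lt_iff_one_lt_mul₀ hτ] at hN'
        have h3 : 1 ≤ (2 ^ (N + 1) * τ) ^ η := Real.one_le_rpow h2.le h0.le
        have h4 : ((2 : ℝ) ^ (N + 1)) ^ η * q ^ (N + 1) = 1 := by
          rw [hq, ← Real.rpow_natCast, ← Real.rpow_natCast, ← Real.rpow_mul (by norm_num),
            ← Real.rpow_mul (by norm_num), ← Real.rpow_add (by norm_num)]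
          ring_nf
          simp
        rw [Real.mul_rpow (by positivity) hτ.le] at h3
        have h5 : q ^ (N + 1) ≤ τ ^ η := by
          calc q ^ (N + 1) ≤ q ^ (N + 1) * (((2 : ℝ) ^ (N + 1)) ^ η * τ ^ η) :=
                le_mul_of_one_le_right (by positivity) h3
            _ = ((2 : ℝ) ^ (N + 1)) ^ η * q ^ (N + 1) * τ ^ η := by ring
            _ = τ ^ η := by rw [h4, one_mul]
        rw [pow_succ] at h5
        nlinarith [pow_pos hq0 N]
  refine ⟨N, fun n => ?_⟩
  rcases le_or_gt N n with h | h
  · have h2 : n - N + (N - n) = n - N := by omega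
    calc q ^ n * min 1 ((2 ^ n * τ) ^ 2) ≤ q ^ n * 1 := by gcongr; exact min_le_left _ _
      _ = q ^ N * q ^ (n - N) := by rw [mul_one, ← pow_add, Nat.add_sub_cancel' h]
      _ ≤ _ := by rw [h2]; gcongr
  · obtain ⟨i, rfl⟩ := Nat.exists_eq_add_of_le h.le
    have h2 : n - (n + i) + (n + i - n) = i := by omega
    rw [h2]
    have h3 : (2 ^ i * (2 ^ n * τ)) ^ 2 ≤ 1 := by
      refine pow_le_one₀ (by positivity) ?_
      rw [← mul_assoc, ← pow_add, add_comm i n]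
      exact hN1 (by omega)
    have h4 : (1 : ℝ) ≤ (q * q * 4) ^ i := one_le_pow₀ (by nlinarith)
    have h5 : (4 : ℝ) ^ i = (2 ^ i) ^ 2 := by rw [← pow_mul, mul_comm, pow_mul]; norm_num
    calc q ^ n * min 1 ((2 ^ n * τ) ^ 2) ≤ q ^ n * (2 ^ n * τ) ^ 2 := by
          gcongr; exact min_le_right _ _
      _ ≤ q ^ n * (2 ^ n * τ) ^ 2 * (q * q * 4) ^ i := le_mul_of_one_le_right (by positivity) h4
      _ = q ^ (n + i) * (2 ^ i * (2 ^ n * τ)) ^ 2 * q ^ i := by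
          rw [mul_pow, mul_pow, h5, pow_add]; ring
      _ ≤ 2 * τ ^ η * 1 * q ^ i := by gcongr
      _ = _ := by ring

/-- A series whose terms obey both `‖zₙ‖ ≤ P 2^{-nη}` and `‖zₙ‖ ≤ Q 2^{-nη} (2ⁿ τ)²` has a sum of
order `τ^η`. -/
theorem norm_le_of_hasSum_of_two_bounds {E : Type*} [NormedAddCommGroup E] {z : ℕ → E} {b : E}
    {P Q η τ : ℝ} (h : HasSum z b) (h0 : 0 < η) (h1 : η ≤ 1) (hτ : 0 < τ) (hP : 0 ≤ P)
    (hQ : 0 ≤ Q) (hfar : ∀ n, ‖z n‖ ≤ P * ((2 : ℝ) ^ (-η)) ^ n)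
    (hnear : ∀ n, ‖z n‖ ≤ Q * ((2 : ℝ) ^ (-η)) ^ n * (2 ^ n * τ) ^ 2) :
    ‖b‖ ≤ (P + Q) * (4 * (1 - (2 : ℝ) ^ (-η))⁻¹) * τ ^ η := by
  have hq0 : (0 : ℝ) ≤ (2 : ℝ) ^ (-η) := by positivity
  have hq1 : (2 : ℝ) ^ (-η) < 1 := Real.rpow_lt_one_of_one_lt_of_neg one_lt_two (by linarith)
  obtain ⟨N, hN⟩ := exists_two_sided_decay h0 h1 hτ
  obtain ⟨hs1, hs2⟩ := summable_two_sided_geometric hq0 hq1 N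
  generalize (2 : ℝ) ^ (-η) = q at *
  have hterm : ∀ n, ‖z n‖ ≤ (P + Q) * (2 * τ ^ η) * q ^ (n - N + (N - n)) := fun n => by
    have h2 : ‖z n‖ ≤ (P + Q) * (q ^ n * min 1 ((2 ^ n * τ) ^ 2)) := by
      rcases min_choice 1 ((2 ^ n * τ) ^ 2) with h3 | h3
      · rw [h3]
        refine (hfar n).trans ?_
        have : 0 ≤ Q * q ^ n := by positivity
        linarith
      · rw [h3]
        refine (hnear n).trans ?_
        have : 0 ≤ P * (q ^ n * (2 ^ n * τ) ^ 2) := by positivity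
        linarith
    refine h2.trans ((mul_le_mul_of_nonneg_left (hN n) (add_nonneg hP hQ)).trans_eq ?_)
    ring
  rw [← h.tsum_eq]
  refine (tsum_of_norm_bounded (hs1.hasSum.mul_left _) hterm).trans ?_
  calc _ ≤ (P + Q) * (2 * τ ^ η) * (2 * (1 - q)⁻¹) := by gcongr
    _ = _ := by ring

variable {d : ℕ}

namespace AutomorphismGroup

variable {A : Type*} [NormedRing A] [NormedAlgebra ℂ A] (Ψ : AutomorphismGroup d A)
  {m θ : Rd d → ℂ} {a : A} {x : ℕ → A}

theorem mem_contElements_of_hasSum (hx : ∀ n, x n ∈ Ψ.contElements) (h : HasSum x a) :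
    a ∈ Ψ.contElements :=
  Ψ.isClosed_contElements.mem_of_tendsto h
    (Eventually.of_forall fun _ => Ψ.contSubmodule.sum_mem fun n _ => hx n)

theorem hasSum_psi (h : HasSum x a) (t : Rd d) : HasSum (fun n => Ψ.psi t (x n)) (Ψ.psi t a) :=
  h.mapL (Ψ.psiCLM t)

theorem hasSum_diff (h : HasSum x a) (t : Rd d) : HasSum (fun n => Ψ.diff t (x n)) (Ψ.diff t a) :=
  (Ψ.hasSum_psi h t).sub h

/-- The generators are closed operators: a series may be differentiated termwise if the series of
derivatives converges absolutely. -/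
theorem hasDerivAt_orbit_of_hasSum [CompleteSpace A] {j : Fin d} {y : ℕ → A} {u : ℕ → ℝ}
    (h : HasSum x a) (hd : ∀ n, HasDerivAt (Ψ.orbit j (x n)) (y n) 0) (hu : Summable u)
    (hy : ∀ n, ‖y n‖ ≤ u n) : HasDerivAt (Ψ.orbit j a) (∑' n, y n) 0 := by
  have key := hasDerivAt_tsum (𝕜 := ℝ) (g := fun n => Ψ.orbit j (x n))
    (g' := fun n s => Ψ.psi (s • EuclideanSpace.single j (1 : ℝ)) (y n)) (y₀ := 0)
    (hu.mul_left Ψ.bound) (fun n s => Ψ.hasDerivAt_orbit_of_zero (hd n) s)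
    (fun n _ => (Ψ.norm_psi_le _ _).trans (by gcongr; exacts [Ψ.bound_nonneg, hy n]))
    (Ψ.hasSum_psi h _).summable 0
  simp only [zero_smul, Ψ.psi_zero] at key
  refine key.congr_of_eventuallyEq (Eventually.of_forall fun s => ?_)
  exact (Ψ.hasSum_psi h _).tsum_eq.symm

/-- First differences are controlled by the generators. -/
theorem norm_diff_le_of_hasDerivAt {D : ℝ} {b : Fin d → A}
    (hd : ∀ j, HasDerivAt (Ψ.orbit j a) (b j) 0) (hb : ∀ j, ‖b j‖ ≤ D) (t : Rd d) :
    ‖Ψ.diff t a‖ ≤ Ψ.bound ^ 2 * D * l1norm t := by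
  have hline : ∀ (j : Fin d) (x : ℝ),
      ‖Ψ.diff (x • EuclideanSpace.single j (1 : ℝ)) a‖ ≤ Ψ.bound * D * |x| := fun j x => by
    have h := Convex.norm_image_sub_le_of_norm_hasDerivWithin_le (𝕜 := ℝ) (s := Set.univ)
      (f := Ψ.orbit j a) (C := Ψ.bound * D) (x := 0) (y := x)
      (fun s _ => (Ψ.hasDerivAt_orbit_of_zero (hd j) s).hasDerivWithinAt)
      (fun s _ => (Ψ.norm_psi_le _ _).trans (by gcongr; exacts [Ψ.bound_nonneg, hb j]))
      convex_univ (Set.mem_univ _) (Set.mem_univ _)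
    simpa [orbit, Ψ.psi_zero, diff] using h
  -- `ψ_{u+v} - 1 = ψ_u (ψ_v - 1) + (ψ_u - 1)`, so the coordinates can be treated one by one
  have hsum : ∀ s : Finset (Fin d),
      ‖Ψ.diff (∑ j ∈ s, t j • EuclideanSpace.single j (1 : ℝ)) a‖ ≤
        ∑ j ∈ s, Ψ.bound * (Ψ.bound * D * |t j|) := fun s => by
    induction s using Finset.induction_on with
    | empty => simp [diff, Ψ.psi_zero]
    | insert j s hj ih =>
      rw [Finset.sum_insert hj, Finset.sum_insert hj]
      set u := ∑ j ∈ s, t j • EuclideanSpace.single j (1 : ℝ)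
      set v := t j • EuclideanSpace.single j (1 : ℝ)
      have h1 : Ψ.diff (v + u) a = Ψ.psi u (Ψ.diff v a) + Ψ.diff u a := by
        simp only [diff, map_sub, Ψ.psi_psi, add_comm v u]
        abel
      rw [h1]
      refine (norm_add_le _ _).trans (add_le_add ((Ψ.norm_psi_le _ _).trans ?_) ih)
      exact mul_le_mul_of_nonneg_left (hline j _) Ψ.bound_nonneg
  have ht : ∑ j, t j • EuclideanSpace.single j (1 : ℝ) = t := by
    ext i
    simp [Finset.sum_apply, Pi.single_apply]
  have h := hsum Finset.univ
  rw [ht] at h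
  refine h.trans_eq ?_
  rw [l1norm, Finset.mul_sum]
  exact Finset.sum_congr rfl fun j _ => by ring

/-- Bernstein's inequality for the symbol `θ` dilated to frequencies of size `2ⁿ`. -/
theorem norm_mult_wordSymbol_le (hθ : IsMultiplier θ) (w : List (Fin d)) (n : ℕ) (a : A) :
    ‖Ψ.mult (fun ξ => wordSymbol w ξ * θ (((2 : ℝ) ^ n)⁻¹ • ξ)) a‖ ≤
      (2 ^ n) ^ w.length * Ψ.symbolNorm (fun ξ => wordSymbol w ξ * θ ξ) * ‖a‖ := by
  have hW : IsMultiplier fun ξ => wordSymbol w ξ * θ ξ := hθ.mul_left (contDiff_wordSymbol w)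
  have h2 : (0 : ℝ) < 2 ^ n := by positivity
  have h1 : (fun ξ => wordSymbol w ξ * θ (((2 : ℝ) ^ n)⁻¹ • ξ)) = fun ξ =>
      (((2 ^ n) ^ w.length : ℝ) : ℂ) *
        (wordSymbol w (((2 : ℝ) ^ n)⁻¹ • ξ) * θ (((2 : ℝ) ^ n)⁻¹ • ξ)) := by
    funext ξ
    have h3 : (((2 : ℝ) ^ n : ℝ) : ℂ) ^ w.length ≠ 0 := pow_ne_zero _ (by simp)
    rw [wordSymbol_smul, Complex.ofReal_inv, inv_pow, Complex.ofReal_pow, ← mul_assoc, ← mul_assoc,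
      mul_inv_cancel₀ h3, one_mul]
  rw [h1, mult_symbol_smul, norm_smul, Complex.norm_real, Real.norm_of_nonneg (by positivity),
    mul_assoc]
  gcongr
  refine (Ψ.norm_mult_le (hW.comp_smul (inv_ne_zero h2.ne')) a).trans_eq ?_
  rw [Ψ.symbolNorm_comp_smul (fun ξ => wordSymbol w ξ * θ ξ) h2]

theorem norm_diff_diff_mult_le [CompleteSpace A] {D : ℝ} (hm : IsMultiplier m)
    (ha : a ∈ Ψ.contElements)
    (hD : ∀ i j, ‖Ψ.mult (fun ξ => genSymbol i ξ * (genSymbol j ξ * m ξ)) a‖ ≤ D) (t : Rd d) :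
    ‖Ψ.diff t (Ψ.diff t (Ψ.mult m a))‖ ≤ Ψ.bound ^ 4 * D * l1norm t ^ 2 := by
  have h1 : IsMultiplier fun ξ => (character t ξ - 1) * m ξ :=
    hm.mul_left ((contDiff_character t).sub contDiff_const)
  have h2 : ∀ j, IsMultiplier fun ξ => genSymbol j ξ * m ξ := fun j =>
    hm.mul_left (contDiff_genSymbol j)
  have h3 : ∀ j, ‖Ψ.mult (fun ξ => genSymbol j ξ * ((character t ξ - 1) * m ξ)) a‖ ≤
      Ψ.bound ^ 2 * D * l1norm t := fun j => by
    have h4 : (fun ξ => genSymbol j ξ * ((character t ξ - 1) * m ξ)) =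
        fun ξ => (character t ξ - 1) * (genSymbol j ξ * m ξ) := by
      funext ξ
      ring
    rw [h4, ← Ψ.diff_mult (h2 j) ha]
    exact Ψ.norm_diff_le_of_hasDerivAt (fun i => Ψ.hasDerivAt_orbit_mult (h2 j) ha i)
      (fun i => hD i j) t
  rw [Ψ.diff_mult hm ha]
  refine (Ψ.norm_diff_le_of_hasDerivAt (fun i => Ψ.hasDerivAt_orbit_mult h1 ha i) h3 t).trans_eq ?_
  ring

/-- The sum over `i` and `j` of the bounds `symbolNorm` for the norms of `δ_i δ_j δ_w θ(D)`. -/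
noncomputable def secondSymbolNorm (w : List (Fin d)) (θ : Rd d → ℂ) : ℝ :=
  ∑ i, ∑ j, Ψ.symbolNorm fun ξ => wordSymbol (i :: j :: w) ξ * θ ξ

theorem secondSymbolNorm_nonneg (w : List (Fin d)) (θ : Rd d → ℂ) :
    0 ≤ Ψ.secondSymbolNorm w θ :=
  Finset.sum_nonneg fun _ _ => Finset.sum_nonneg fun _ _ => Ψ.symbolNorm_nonneg _

theorem symbolNorm_le_secondSymbolNorm (w : List (Fin d)) (θ : Rd d → ℂ) (i j : Fin d) :
    Ψ.symbolNorm (fun ξ => wordSymbol (i :: j :: w) ξ * θ ξ) ≤ Ψ.secondSymbolNorm w θ := by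
  refine le_trans ?_ (Finset.single_le_sum (fun i _ => Finset.sum_nonneg fun j _ =>
    Ψ.symbolNorm_nonneg fun ξ => wordSymbol (i :: j :: w) ξ * θ ξ) (Finset.mem_univ i))
  exact Finset.single_le_sum (fun j _ =>
    Ψ.symbolNorm_nonneg fun ξ => wordSymbol (i :: j :: w) ξ * θ ξ) (Finset.mem_univ j)

/-- A series `a = ∑ xₙ` whose terms have frequencies of size at most `2ⁿ`, as witnessed by the
dilates of a multiplier `θ`, and norms at most `K 2^{-rn}`. -/
structure IsDyadicExpansion (θ : Rd d → ℂ) (r K : ℝ) (x : ℕ → A) (a : A) : Prop where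
  multiplier : IsMultiplier θ
  mem : ∀ n, x n ∈ Ψ.contElements
  localized : ∀ n, Ψ.mult (fun ξ => θ (((2 : ℝ) ^ n)⁻¹ • ξ)) (x n) = x n
  norm_le : ∀ n, ‖x n‖ ≤ K * ((2 : ℝ) ^ (-r)) ^ n
  hasSum : HasSum x a

namespace IsDyadicExpansion

variable {Ψ} {r K : ℝ}

theorem isMultiplier_word (h : Ψ.IsDyadicExpansion θ r K x a) (w : List (Fin d)) (n : ℕ) :
    IsMultiplier fun ξ => wordSymbol w ξ * θ (((2 : ℝ) ^ n)⁻¹ • ξ) :=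
  (h.multiplier.comp_smul (inv_ne_zero (by positivity))).mul_left (contDiff_wordSymbol w)

theorem norm_word_le (h : Ψ.IsDyadicExpansion θ r K x a) (w : List (Fin d)) (n : ℕ) :
    ‖Ψ.mult (fun ξ => wordSymbol w ξ * θ (((2 : ℝ) ^ n)⁻¹ • ξ)) (x n)‖ ≤
      Ψ.symbolNorm (fun ξ => wordSymbol w ξ * θ ξ) * K * ((2 : ℝ) ^ (w.length - r)) ^ n := by
  refine (Ψ.norm_mult_wordSymbol_le h.multiplier w n _).trans ?_
  have h1 : ((2 : ℝ) ^ (w.length - r)) ^ n = (2 ^ n) ^ w.length * ((2 : ℝ) ^ (-r)) ^ n := by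
    rw [sub_eq_add_neg, Real.rpow_add (by norm_num), mul_pow, Real.rpow_natCast, ← pow_mul,
      ← pow_mul, mul_comm n]
  rw [h1]
  calc _ ≤ (2 ^ n) ^ w.length * Ψ.symbolNorm (fun ξ => wordSymbol w ξ * θ ξ) *
        (K * ((2 : ℝ) ^ (-r)) ^ n) := by
        gcongr
        · exact mul_nonneg (by positivity) (Ψ.symbolNorm_nonneg _)
        · exact h.norm_le n
    _ = _ := by ring

theorem two_rpow_lt_one {s : ℝ} (hs : s < 0) : (2 : ℝ) ^ s < 1 :=
  Real.rpow_lt_one_of_one_lt_of_neg one_lt_two hs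

variable [CompleteSpace A]

theorem mem_genWordDomain (h : Ψ.IsDyadicExpansion θ r K x a) {w : List (Fin d)}
    (hw : (w.length : ℝ) < r) : a ∈ Ψ.genWordDomain w ∧
      HasSum (fun n => Ψ.mult (fun ξ => wordSymbol w ξ * θ (((2 : ℝ) ^ n)⁻¹ • ξ)) (x n))
        (Ψ.genWord w a) := by
  induction w with
  | nil =>
    refine ⟨Ψ.mem_contElements_of_hasSum h.mem h.hasSum, ?_⟩
    simpa [wordSymbol, genWord, h.localized] using h.hasSum
  | cons j w ih =>
    obtain ⟨h1, h2⟩ := ih (by simp only [List.length_cons] at hw; push_cast at hw; linarith)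
    set z : ℕ → A := fun n =>
      Ψ.mult (fun ξ => wordSymbol (j :: w) ξ * θ (((2 : ℝ) ^ n)⁻¹ • ξ)) (x n) with hz
    have hu : Summable fun n => Ψ.symbolNorm (fun ξ => wordSymbol (j :: w) ξ * θ ξ) * K *
        ((2 : ℝ) ^ ((j :: w).length - r)) ^ n :=
      (summable_geometric_of_lt_one (by positivity) (two_rpow_lt_one (by linarith))).mul_left _
    have hzd : ∀ n, HasDerivAt (Ψ.orbit j
        (Ψ.mult (fun ξ => wordSymbol w ξ * θ (((2 : ℝ) ^ n)⁻¹ • ξ)) (x n))) (z n) 0 := fun n => by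
      have h3 := Ψ.hasDerivAt_orbit_mult (h.isMultiplier_word w n) (h.mem n) j
      simpa only [hz, wordSymbol_cons, mul_assoc] using h3
    have h4 := Ψ.hasDerivAt_orbit_of_hasSum h2 hzd hu (h.norm_word_le (j :: w))
    have h5 : Ψ.genWord (j :: w) a = ∑' n, z n := h4.deriv
    have h6 : HasSum z (∑' n, z n) := (hu.of_norm_bounded (h.norm_word_le (j :: w))).hasSum
    refine ⟨⟨h1, h4.differentiableAt, ?_⟩, by rwa [h5]⟩
    change Ψ.genWord (j :: w) a ∈ _
    rw [h5]
    exact Ψ.mem_contElements_of_hasSum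
      (fun n => Ψ.mult_mem (h.isMultiplier_word (j :: w) n) (h.mem n)) h6

theorem norm_genWord_le (h : Ψ.IsDyadicExpansion θ r K x a) {w : List (Fin d)}
    (hw : (w.length : ℝ) < r) : ‖Ψ.genWord w a‖ ≤
      Ψ.symbolNorm (fun ξ => wordSymbol w ξ * θ ξ) * (1 - (2 : ℝ) ^ (w.length - r))⁻¹ * K := by
  rw [← (h.mem_genWordDomain hw).2.tsum_eq]
  refine (tsum_of_norm_bounded ((hasSum_geometric_of_lt_one (by positivity)
    (two_rpow_lt_one (by linarith))).mul_left _) (h.norm_word_le w)).trans_eq ?_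
  ring

theorem norm_diff_diff_word_le (h : Ψ.IsDyadicExpansion θ r K x a) (hK : 0 ≤ K)
    (w : List (Fin d)) (n : ℕ) (t : Rd d) :
    ‖Ψ.diff t (Ψ.diff t (Ψ.mult (fun ξ => wordSymbol w ξ * θ (((2 : ℝ) ^ n)⁻¹ • ξ)) (x n)))‖ ≤
      Ψ.bound ^ 4 * Ψ.secondSymbolNorm w θ * K *
        ((2 : ℝ) ^ (w.length - r)) ^ n * (2 ^ n * l1norm t) ^ 2 := by
  have hsecond : ∀ i j, ‖Ψ.mult (fun ξ => genSymbol i ξ *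
      (genSymbol j ξ * (wordSymbol w ξ * θ (((2 : ℝ) ^ n)⁻¹ • ξ)))) (x n)‖ ≤
      Ψ.secondSymbolNorm w θ * K * (4 * (2 : ℝ) ^ (w.length - r)) ^ n := fun i j => by
    have h1 : (fun ξ => genSymbol i ξ *
        (genSymbol j ξ * (wordSymbol w ξ * θ (((2 : ℝ) ^ n)⁻¹ • ξ)))) =
        fun ξ => wordSymbol (i :: j :: w) ξ * θ (((2 : ℝ) ^ n)⁻¹ • ξ) := by
      funext ξ
      simp only [wordSymbol_cons, mul_assoc]
    have h2 : (2 : ℝ) ^ (((i :: j :: w).length : ℝ) - r) = 4 * (2 : ℝ) ^ (w.length - r) := by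
      have h3 : ((i :: j :: w).length : ℝ) - r = (2 : ℕ) + (w.length - r) := by
        rw [List.length_cons, List.length_cons]
        push_cast
        ring
      rw [h3, Real.rpow_add (by norm_num), Real.rpow_natCast]
      norm_num
    have h5 := h.norm_word_le (i :: j :: w) n
    rw [h2] at h5
    rw [h1]
    refine h5.trans ?_
    have h6 : 0 ≤ (4 * (2 : ℝ) ^ (w.length - r)) ^ n := by positivity
    exact mul_le_mul_of_nonneg_right
      (mul_le_mul_of_nonneg_right (Ψ.symbolNorm_le_secondSymbolNorm w θ i j) hK) h6
  refine (Ψ.norm_diff_diff_mult_le (h.isMultiplier_word w n) (h.mem n) hsecond t).trans_eq ?_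
  have h5 : (4 : ℝ) ^ n = (2 ^ n) ^ 2 := by rw [← pow_mul, mul_comm, pow_mul]; norm_num
  rw [mul_pow, h5]
  ring

/-- The second differences of `δ_w a` are summed over the frequencies: above `1 / |t|` they are
estimated trivially, below by the second derivatives. -/
theorem norm_diff_diff_genWord_le (h : Ψ.IsDyadicExpansion θ r K x a) (hK : 0 ≤ K)
    {w : List (Fin d)} {η : ℝ} (h0 : 0 < η) (h1 : η ≤ 1) (hw : r = w.length + η) {t : Rd d}
    (ht : t ≠ 0) :
    ‖Ψ.diff t (Ψ.diff t (Ψ.genWord w a))‖ ≤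
      ((2 * Ψ.bound) ^ 2 * Ψ.symbolNorm (fun ξ => wordSymbol w ξ * θ ξ) * K +
        Ψ.bound ^ 4 * Ψ.secondSymbolNorm w θ * K) *
        (4 * (1 - (2 : ℝ) ^ (-η))⁻¹) * l1norm t ^ η := by
  have hM := Ψ.bound_nonneg
  have hB0 := Ψ.symbolNorm_nonneg (fun ξ => wordSymbol w ξ * θ ξ)
  have hE0 := Ψ.secondSymbolNorm_nonneg w θ
  have hexp : (w.length : ℝ) - r = -η := by rw [hw]; ring
  have hsum := Ψ.hasSum_diff (Ψ.hasSum_diff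
    (h.mem_genWordDomain (w := w) (by rw [hw]; linarith)).2 t) t
  refine norm_le_of_hasSum_of_two_bounds hsum h0 h1 (l1norm_pos ht)
    (mul_nonneg (mul_nonneg (sq_nonneg _) hB0) hK)
    (mul_nonneg (mul_nonneg (pow_nonneg hM 4) hE0) hK) (fun n => ?_) (fun n => ?_)
  · have hy := h.norm_word_le w n
    rw [hexp] at hy
    refine (Ψ.norm_diff_le t _).trans ?_
    calc _ ≤ 2 * Ψ.bound * (2 * Ψ.bound * (Ψ.symbolNorm (fun ξ => wordSymbol w ξ * θ ξ) * K *
          ((2 : ℝ) ^ (-η)) ^ n)) := by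
          refine mul_le_mul_of_nonneg_left ((Ψ.norm_diff_le t _).trans ?_) (by linarith)
          exact mul_le_mul_of_nonneg_left hy (by linarith)
      _ = _ := by ring
  · have h3 := h.norm_diff_diff_word_le hK w n t
    rwa [hexp] at h3

end IsDyadicExpansion

end AutomorphismGroup

end BanachSmooth

/-! ### The Littlewood–Paley norm -/

namespace BanachSmooth

variable {d : ℕ}

theorem intPart_add_fracPart {r : ℝ} (hr : 0 < r) :
    r = intPart r + fracPart r ∧ 0 < fracPart r ∧ fracPart r ≤ 1 := by
  have h1 : 1 ≤ ⌈r⌉₊ := Nat.one_le_ceil_iff.2 hr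
  have h2 : (intPart r : ℝ) = ⌈r⌉₊ - 1 := by rw [intPart, Nat.cast_sub h1, Nat.cast_one]
  have h3 := Nat.ceil_lt_add_one hr.le
  have h4 := Nat.le_ceil r
  refine ⟨by rw [fracPart]; ring, ?_, ?_⟩ <;> rw [fracPart, h2] <;> linarith

namespace IsDyadicPartition

variable {φ : ℕ → Rd d → ℝ}

theorem isMultiplier (hφ : IsDyadicPartition φ) (n : ℕ) : IsMultiplier fun ξ => (φ n ξ : ℂ) := by
  obtain ⟨⟨ψ, hψ, -, hsucc⟩, h0, -⟩ := hφ.exists_multipliers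
  cases n with
  | zero => exact h0
  | succ n =>
    simp only [hsucc]
    exact hψ.comp_smul (inv_ne_zero (by positivity))

theorem norm_le_of_ne_zero (hφ : IsDyadicPartition φ) {n : ℕ} {ξ : Rd d} (h : φ n ξ ≠ 0) :
    ‖ξ‖ ≤ 2 ^ n := by
  obtain ⟨⟨ψ, -, hsupp, hsucc⟩, -, -, hzero, -⟩ := hφ.exists_multipliers
  cases n with
  | zero =>
    by_contra hcon
    exact h (hzero ξ (by simpa using hcon))
  | succ n =>
    have h1 : ψ (((2 : ℝ) ^ n)⁻¹ • ξ) ≠ 0 := by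
      rw [← hsucc]
      exact_mod_cast h
    have h2 := (hsupp (subset_tsupport _ h1)).2
    rw [norm_smul, Real.norm_of_nonneg (by positivity), inv_mul_le_iff₀ (by positivity)] at h2
    rwa [pow_succ]

/-- The dilates of `φ₀(· / 4)` are equal to `1` on the support of the `φₙ`. -/
theorem dilate_mul_eq (hφ : IsDyadicPartition φ) (n : ℕ) (ξ : Rd d) :
    (φ 0 ((4 : ℝ)⁻¹ • ((2 : ℝ) ^ n)⁻¹ • ξ) : ℂ) * (φ n ξ : ℂ) = φ n ξ := by
  by_cases h : φ n ξ = 0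
  · simp [h]
  · have h1 : ‖(4 : ℝ)⁻¹ • ((2 : ℝ) ^ n)⁻¹ • ξ‖ < 2⁻¹ := by
      rw [norm_smul, norm_smul, Real.norm_of_nonneg (by positivity),
        Real.norm_of_nonneg (by positivity)]
      have h2 : ((2 : ℝ) ^ n)⁻¹ * ‖ξ‖ ≤ 1 := by
        rw [inv_mul_le_iff₀ (by positivity), mul_one]
        exact hφ.norm_le_of_ne_zero h
      linarith
    rw [hφ.exists_multipliers.2.2.1 _ h1, Complex.ofReal_one, one_mul]

end IsDyadicPartition

namespace AutomorphismGroup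

variable {A : Type*} [NormedRing A] [NormedAlgebra ℂ A] (Ψ : AutomorphismGroup d A)
  {φ : ℕ → Rd d → ℝ} {a b : A} {r : ℝ}

theorem Ck_subset (k : ℕ) : Ψ.Ck k ⊆ Ψ.contElements := fun a ha =>
  Ψ.genWordDomain_subset (indexWord 0) (ha 0 (by simp))

theorem littlewoodPaley_eq (φ : ℕ → Rd d → ℝ) (r : ℝ) (a : A) :
    Ψ.littlewoodPaley φ r a = ⨆ k : ℕ, ENNReal.ofReal ((2 : ℝ) ^ (r * k) *
      ‖Ψ.mult (fun ξ => (φ k ξ : ℂ)) a‖) := rfl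

theorem norm_mult_le_of_littlewoodPaley (h : Ψ.littlewoodPaley φ r a < ∞) (n : ℕ) :
    ‖Ψ.mult (fun ξ => (φ n ξ : ℂ)) a‖ ≤
      (Ψ.littlewoodPaley φ r a).toReal * ((2 : ℝ) ^ (-r)) ^ n := by
  have h1 : ENNReal.ofReal ((2 : ℝ) ^ (r * n) * ‖Ψ.mult (fun ξ => (φ n ξ : ℂ)) a‖) ≤
      Ψ.littlewoodPaley φ r a :=
    le_iSup (fun k : ℕ => ENNReal.ofReal ((2 : ℝ) ^ (r * k) *
      ‖Ψ.mult (fun ξ => (φ k ξ : ℂ)) a‖)) n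
  rw [ENNReal.ofReal_le_iff_le_toReal h.ne] at h1
  rw [← Real.rpow_natCast, ← Real.rpow_mul (by norm_num), neg_mul, Real.rpow_neg (by norm_num),
    ← div_eq_mul_inv, le_div_iff₀ (by positivity), mul_comm]
  exact h1

theorem norm_le_CkNorm (k : ℕ) (a : A) : ‖a‖ ≤ Ψ.CkNorm k a := by
  have hterm : ∀ α : Fin d → ℕ,
      0 ≤ (∏ j, ((α j).factorial : ℝ))⁻¹ * ‖Ψ.genPow α a‖ := fun α => by positivity
  have h0 : (0 : Fin d → ℕ) ∈ multiIndices d 0 := (mem_multiIndices 0).2 (by simp)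
  refine le_trans ?_ (Finset.single_le_sum (fun n _ => Finset.sum_nonneg fun α _ => hterm α)
    (Finset.mem_range.2 (Nat.succ_pos k)))
  refine le_trans ?_ (Finset.single_le_sum (fun α _ => hterm α) h0)
  have h1 : indexWord (0 : Fin d → ℕ) = [] :=
    List.length_eq_zero_iff.1 (by simp [length_indexWord])
  simp [genPow, h1, genWord]

theorem norm_diff_diff_le_zygmundNorm {t : Rd d} (ht : t ≠ 0) (h : Ψ.zygmundNorm r a < ∞)
    {α : Fin d → ℕ} (hα : α ∈ multiIndices d (intPart r)) :
    ‖Ψ.diff t (Ψ.diff t (Ψ.genPow α a))‖ ≤ (Ψ.zygmundNorm r a).toReal * l1norm t ^ fracPart r := by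
  have h1 : Ψ.zygmundSeminorm (fracPart r) (Ψ.genPow α a) ≤ Ψ.zygmundNorm r a :=
    (Finset.single_le_sum (f := fun α => Ψ.zygmundSeminorm (fracPart r) (Ψ.genPow α a))
      (fun _ _ => zero_le) hα).trans le_add_self
  have h2 : ENNReal.ofReal (l1norm t ^ (-fracPart r) * ‖Ψ.diff t (Ψ.diff t (Ψ.genPow α a))‖) ≤
      Ψ.zygmundSeminorm (fracPart r) (Ψ.genPow α a) :=
    le_iSup₂ (f := fun (t : Rd d) (_ : t ≠ 0) => ENNReal.ofReal
      (l1norm t ^ (-fracPart r) * ‖Ψ.diff t (Ψ.diff t (Ψ.genPow α a))‖)) t ht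
  have h3 := (ENNReal.ofReal_le_iff_le_toReal h.ne).1 (h2.trans h1)
  have h4 := l1norm_pos ht
  rwa [Real.rpow_neg h4.le, inv_mul_le_iff₀ (by positivity), mul_comm] at h3

theorem littlewoodPaley_add_le (hφ : IsDyadicPartition φ) (ha : a ∈ Ψ.contElements)
    (hb : b ∈ Ψ.contElements) : Ψ.littlewoodPaley φ r (a + b) ≤
      Ψ.littlewoodPaley φ r a + Ψ.littlewoodPaley φ r b := by
  refine iSup_le fun n => ?_
  change ENNReal.ofReal (_ * ‖Ψ.mult (fun ξ => (φ n ξ : ℂ)) (a + b)‖) ≤ _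
  rw [Ψ.mult_add (hφ.isMultiplier n) ha hb]
  refine (ENNReal.ofReal_le_ofReal (mul_le_mul_of_nonneg_left (norm_add_le _ _)
    (by positivity))).trans ?_
  rw [mul_add, ENNReal.ofReal_add (by positivity) (by positivity)]
  exact add_le_add (le_iSup (fun k : ℕ => ENNReal.ofReal ((2 : ℝ) ^ (r * k) *
      ‖Ψ.mult (fun ξ => (φ k ξ : ℂ)) a‖)) n) (le_iSup (fun k : ℕ => ENNReal.ofReal
      ((2 : ℝ) ^ (r * k) * ‖Ψ.mult (fun ξ => (φ k ξ : ℂ)) b‖)) n)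

theorem littlewoodPaley_smul (φ : ℕ → Rd d → ℝ) (r : ℝ) (c : ℂ) (a : A) :
    Ψ.littlewoodPaley φ r (c • a) = ENNReal.ofReal ‖c‖ * Ψ.littlewoodPaley φ r a := by
  rw [littlewoodPaley_eq, littlewoodPaley_eq, ENNReal.mul_iSup]
  congr 1
  funext n
  rw [mult_smul, norm_smul, ← ENNReal.ofReal_mul (norm_nonneg c)]
  congr 1
  ring

variable [CompleteSpace A]

theorem tendsto_sum_mult (hφ : IsDyadicPartition φ) (ha : a ∈ Ψ.contElements) :
    Tendsto (fun N => ∑ n ∈ Finset.range (N + 1), Ψ.mult (fun ξ => (φ n ξ : ℂ)) a) atTop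
      (𝓝 a) := by
  obtain ⟨-, -, hone, -, hsum⟩ := hφ.exists_multipliers
  have h := Ψ.tendsto_mult_comp_smul (hφ.isMultiplier 0) ha (c := fun N => (2 : ℝ) ^ N)
    (fun n => by positivity) (tendsto_pow_atTop_atTop_of_one_lt one_lt_two)
  rw [hone 0 (by simp), Complex.ofReal_one, one_smul] at h
  refine h.congr fun N => ?_
  rw [← Ψ.mult_symbol_sum (fun n _ => hφ.isMultiplier n) ha]
  congr 1
  funext ξ
  rw [← hsum]
  push_cast
  rfl

/-- The Littlewood–Paley decomposition of an element with finite Littlewood–Paley norm. -/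
theorem isDyadicExpansion (hφ : IsDyadicPartition φ) (hr : 0 < r) (ha : a ∈ Ψ.contElements)
    (h : Ψ.littlewoodPaley φ r a < ∞) :
    Ψ.IsDyadicExpansion (fun ξ => (φ 0 ((4 : ℝ)⁻¹ • ξ) : ℂ)) r (Ψ.littlewoodPaley φ r a).toReal
      (fun n => Ψ.mult (fun ξ => (φ n ξ : ℂ)) a) a := by
  have hθ : IsMultiplier fun ξ => (φ 0 ((4 : ℝ)⁻¹ • ξ) : ℂ) :=
    (hφ.isMultiplier 0).comp_smul (by norm_num)
  have hnorm := Ψ.norm_mult_le_of_littlewoodPaley h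
  refine ⟨hθ, fun n => Ψ.mult_mem (hφ.isMultiplier n) ha, fun n => ?_, hnorm, ?_⟩
  · rw [← Ψ.mult_mul (hθ.comp_smul (inv_ne_zero (by positivity))) (hφ.isMultiplier n) ha]
    simp only [hφ.dilate_mul_eq]
  · have hs : Summable fun n => Ψ.mult (fun ξ => (φ n ξ : ℂ)) a :=
      ((summable_geometric_of_lt_one (by positivity) (Real.rpow_lt_one_of_one_lt_of_neg one_lt_two
        (neg_lt_zero.2 hr))).mul_left _).of_norm_bounded hnorm
    have h1 := (tendsto_add_atTop_iff_nat 1).2 hs.hasSum.tendsto_sum_nat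
    have h2 := hs.hasSum
    rwa [tendsto_nhds_unique h1 (Ψ.tendsto_sum_mult hφ ha)] at h2

/-- Smoothness implies decay of the Littlewood–Paley pieces. -/
theorem exists_littlewoodPaley_le (hφ : IsDyadicPartition φ) (hr : 0 < r) :
    ∃ C : ℝ, 0 < C ∧ ∀ a ∈ Ψ.zygmundSpace r,
      Ψ.littlewoodPaley φ r a ≤ ENNReal.ofReal C * Ψ.zygmundNorm r a := by
  obtain ⟨hkη, hη, -⟩ := intPart_add_fracPart hr
  obtain ⟨⟨ψ, hψ, hsupp, hsucc⟩, -⟩ := hφ.exists_multipliers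
  obtain ⟨C, hC, hest⟩ := Ψ.exists_norm_mult_le_sum_diff hψ hsupp (intPart r)
  set η := fracPart r
  set k := intPart r
  set C₀ := Ψ.symbolNorm fun ξ => (φ 0 ξ : ℂ) with hC₀
  have hC₀n : 0 ≤ C₀ := Ψ.symbolNorm_nonneg _
  have hCn : 0 ≤ ∑ j, C j := Finset.sum_nonneg fun j _ => hC j
  refine ⟨C₀ + 2 ^ r * ∑ j, C j + 1, by positivity, fun a ha => ?_⟩
  set Z := (Ψ.zygmundNorm r a).toReal with hZ
  have hZ0 : 0 ≤ Z := ENNReal.toReal_nonneg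
  have haZ : ‖a‖ ≤ Z := (Ψ.norm_le_CkNorm _ a).trans
    ((ENNReal.ofReal_le_iff_le_toReal ha.2.ne).1 le_self_add)
  rw [← ENNReal.ofReal_toReal ha.2.ne, ← ENNReal.ofReal_mul (by positivity), littlewoodPaley_eq]
  refine iSup_le fun n => ENNReal.ofReal_le_ofReal ?_
  cases n with
  | zero =>
    rw [Nat.cast_zero, mul_zero, Real.rpow_zero, one_mul]
    calc _ ≤ C₀ * ‖a‖ := Ψ.norm_mult_le (hφ.isMultiplier 0) a
      _ ≤ C₀ * Z := by gcongr
      _ ≤ _ := by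
        gcongr
        have : 0 ≤ 2 ^ r * ∑ j, C j := by positivity
        linarith
  | succ n =>
    simp only [hsucc]
    set c : ℝ := 2 ^ n with hc
    have hc0 : 0 < c := by positivity
    have hpow : (2 : ℝ) ^ (r * ((n + 1 : ℕ) : ℝ)) = 2 ^ r * (c ^ k * c ^ η) := by
      have h1 : c ^ k * c ^ η = c ^ r := by
        rw [← Real.rpow_natCast, ← Real.rpow_add hc0, ← hkη]
      rw [h1, hc, ← Real.rpow_natCast, ← Real.rpow_mul (by norm_num),
        ← Real.rpow_add (by norm_num)]
      congr 1
      push_cast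
      ring
    have hstep : ∀ j : Fin d, ‖Ψ.diff (c⁻¹ • (4⁻¹ : ℝ) • EuclideanSpace.single j (1 : ℝ))
        (Ψ.diff (c⁻¹ • (4⁻¹ : ℝ) • EuclideanSpace.single j (1 : ℝ))
          (Ψ.genWord (List.replicate k j) a))‖ ≤ Z * (c ^ η)⁻¹ := fun j => by
      have hne : c⁻¹ • (4⁻¹ : ℝ) • EuclideanSpace.single j (1 : ℝ) ≠ (0 : Rd d) := by
        simp [hc0.ne']
      have h1 := Ψ.norm_diff_diff_le_zygmundNorm hne ha.2 (α := Pi.single j k)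
        ((mem_multiIndices _).2
          (by simp only [Finset.sum_pi_single', Finset.mem_univ, if_true]; rfl))
      rw [genPow, indexWord_single, smul_smul, l1norm_smul_single, ← smul_smul] at h1
      refine h1.trans (mul_le_mul_of_nonneg_left ?_ hZ0)
      rw [← Real.inv_rpow hc0.le, abs_of_pos (by positivity)]
      refine Real.rpow_le_rpow (by positivity) ?_ hη.le
      have := inv_pos.2 hc0
      linarith
    rw [hpow]
    calc _ ≤ 2 ^ r * (c ^ k * c ^ η) * ((c ^ k)⁻¹ * ∑ j, C j * (Z * (c ^ η)⁻¹)) := by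
          gcongr
          refine (hest c hc0 a ha.1).trans ?_
          gcongr with j
          · exact hC j
          · exact hstep j
      _ = 2 ^ r * (∑ j, C j) * Z := by
          rw [← Finset.sum_mul]
          have : 0 < c ^ η := by positivity
          field_simp
      _ ≤ _ := by
          gcongr
          linarith

/-- Decay of the Littlewood–Paley pieces implies smoothness. -/
theorem exists_zygmundNorm_le (hφ : IsDyadicPartition φ) (hr : 0 < r) :
    ∃ C : ℝ, 0 < C ∧ ∀ a ∈ Ψ.contElements, Ψ.littlewoodPaley φ r a < ∞ →
      a ∈ Ψ.Ck (intPart r) ∧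
        Ψ.zygmundNorm r a ≤ ENNReal.ofReal C * Ψ.littlewoodPaley φ r a := by
  obtain ⟨hkη, hη, hη1⟩ := intPart_add_fracPart hr
  set θ : Rd d → ℂ := fun ξ => (φ 0 ((4 : ℝ)⁻¹ • ξ) : ℂ) with hθ
  set η := fracPart r with hηdef
  set k := intPart r with hkdef
  have hlen : ∀ α : Fin d → ℕ, ∑ j, α j ≤ k → ((indexWord α).length : ℝ) < r := fun α hα => by
    rw [length_indexWord]
    have : ((∑ j, α j : ℕ) : ℝ) ≤ k := by exact_mod_cast hα
    linarith
  set D : (Fin d → ℕ) → ℝ := fun α => Ψ.symbolNorm (fun ξ => wordSymbol (indexWord α) ξ * θ ξ) *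
    (1 - (2 : ℝ) ^ ((indexWord α).length - r))⁻¹ with hD
  set G : (Fin d → ℕ) → ℝ := fun α =>
    ((2 * Ψ.bound) ^ 2 * Ψ.symbolNorm (fun ξ => wordSymbol (indexWord α) ξ * θ ξ) +
      Ψ.bound ^ 4 * Ψ.secondSymbolNorm (indexWord α) θ) * (4 * (1 - (2 : ℝ) ^ (-η))⁻¹) with hG
  have hG0 : ∀ α, 0 ≤ G α := fun α => by
    have h1 := Real.rpow_lt_one_of_one_lt_of_neg one_lt_two (neg_lt_zero.2 hη)
    have h2 : 0 ≤ (1 - (2 : ℝ) ^ (-η))⁻¹ := inv_nonneg.2 (by linarith)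
    have h3 := Ψ.symbolNorm_nonneg fun ξ => wordSymbol (indexWord α) ξ * θ ξ
    have h4 := Ψ.secondSymbolNorm_nonneg (indexWord α) θ
    have h5 := Ψ.bound_nonneg
    exact mul_nonneg (add_nonneg (mul_nonneg (sq_nonneg _) h3)
      (mul_nonneg (pow_nonneg h5 4) h4)) (by linarith)
  have hD0 : ∀ α : Fin d → ℕ, ∑ j, α j ≤ k → 0 ≤ D α := fun α hα => by
    have h1 := Real.rpow_lt_one_of_one_lt_of_neg one_lt_two (sub_neg.2 (hlen α hα))
    exact mul_nonneg (Ψ.symbolNorm_nonneg _) (inv_nonneg.2 (by linarith))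
  set S : ℝ := ∑ n ∈ Finset.range (k + 1), ∑ α ∈ multiIndices d n,
    (∏ j, ((α j).factorial : ℝ))⁻¹ * D α with hS
  have hmem : ∀ n ∈ Finset.range (k + 1), ∀ α ∈ multiIndices d n, ∑ j, α j ≤ k :=
    fun n hn α hα => by
      rw [(mem_multiIndices α).1 hα]
      exact Nat.lt_succ_iff.1 (Finset.mem_range.1 hn)
  have hS0 : 0 ≤ S := Finset.sum_nonneg fun n hn => Finset.sum_nonneg fun α hα =>
    mul_nonneg (by positivity) (hD0 α (hmem n hn α hα))
  have hT0 : 0 ≤ ∑ α ∈ multiIndices d k, G α := Finset.sum_nonneg fun α _ => hG0 α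
  refine ⟨S + ∑ α ∈ multiIndices d k, G α + 1, by linarith, fun a ha hfin => ?_⟩
  have hexp := Ψ.isDyadicExpansion hφ hr ha hfin
  set K := (Ψ.littlewoodPaley φ r a).toReal with hK
  have hK0 : 0 ≤ K := ENNReal.toReal_nonneg
  refine ⟨fun α hα => (hexp.mem_genWordDomain (hlen α hα)).1, ?_⟩
  have hCk : Ψ.CkNorm k a ≤ S * K := by
    rw [hS, CkNorm, Finset.sum_mul]
    refine Finset.sum_le_sum fun n hn => ?_
    rw [Finset.sum_mul]
    refine Finset.sum_le_sum fun α hα => ?_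
    rw [mul_assoc]
    exact mul_le_mul_of_nonneg_left (hexp.norm_genWord_le (hlen α (hmem n hn α hα)))
      (by positivity)
  have hsemi : ∀ α ∈ multiIndices d k,
      Ψ.zygmundSeminorm η (Ψ.genPow α a) ≤ ENNReal.ofReal (G α * K) := fun α hα => by
    refine iSup₂_le fun t ht => ENNReal.ofReal_le_ofReal ?_
    have ht0 := l1norm_pos ht
    have hw : r = (indexWord α).length + η := by
      rw [length_indexWord, (mem_multiIndices α).1 hα]
      exact hkη
    rw [Real.rpow_neg ht0.le, inv_mul_le_iff₀ (by positivity)]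
    refine (hexp.norm_diff_diff_genWord_le hK0 hη hη1 hw ht).trans_eq ?_
    simp only [hG]
    ring
  calc Ψ.zygmundNorm r a
      ≤ ENNReal.ofReal (S * K) + ∑ α ∈ multiIndices d k, ENNReal.ofReal (G α * K) :=
        add_le_add (ENNReal.ofReal_le_ofReal hCk) (Finset.sum_le_sum hsemi)
    _ = ENNReal.ofReal (S * K + ∑ α ∈ multiIndices d k, G α * K) := by
        rw [← ENNReal.ofReal_sum_of_nonneg fun α _ => mul_nonneg (hG0 α) hK0, ENNReal.ofReal_add
          (mul_nonneg hS0 hK0) (Finset.sum_nonneg fun α _ => mul_nonneg (hG0 α) hK0)]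
    _ ≤ ENNReal.ofReal ((S + ∑ α ∈ multiIndices d k, G α + 1) * K) := by
        refine ENNReal.ofReal_le_ofReal ?_
        rw [← Finset.sum_mul]
        linarith
    _ = _ := by rw [ENNReal.ofReal_mul (by linarith), hK, ENNReal.ofReal_toReal hfin.ne]

theorem littlewoodPaley_eq_zero_iff (hφ : IsDyadicPartition φ) (ha : a ∈ Ψ.contElements) :
    Ψ.littlewoodPaley φ r a = 0 ↔ a = 0 := by
  constructor
  · intro h
    have h1 : ∀ n : ℕ, Ψ.mult (fun ξ => (φ n ξ : ℂ)) a = 0 := fun n => by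
      simpa [h] using Ψ.norm_mult_le_of_littlewoodPaley (φ := φ) (r := r) (a := a) (by simp [h]) n
    have h2 := Ψ.tendsto_sum_mult hφ ha
    simp only [h1, Finset.sum_const_zero] at h2
    exact tendsto_nhds_unique h2 tendsto_const_nhds
  · rintro rfl
    simpa using Ψ.littlewoodPaley_smul φ r 0 0

theorem mem_zygmundSpace_iff (hφ : IsDyadicPartition φ) (hr : 0 < r) :
    a ∈ Ψ.zygmundSpace r ↔ a ∈ Ψ.contElements ∧ Ψ.littlewoodPaley φ r a < ∞ := by
  constructor
  · intro ha
    obtain ⟨C, -, hC⟩ := Ψ.exists_littlewoodPaley_le hφ hr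
    exact ⟨Ψ.Ck_subset _ ha.1, (hC a ha).trans_lt (ENNReal.mul_lt_top ENNReal.ofReal_lt_top ha.2)⟩
  · rintro ⟨ha, hfin⟩
    obtain ⟨C, -, hC⟩ := Ψ.exists_zygmundNorm_le hφ hr
    obtain ⟨h1, h2⟩ := hC a ha hfin
    exact ⟨h1, h2.trans_lt (ENNReal.mul_lt_top ENNReal.ofReal_lt_top hfin)⟩

end AutomorphismGroup

end BanachSmooth

theorem mainTheorem12 {d : ℕ} {A : Type*} [NormedRing A] [NormedAlgebra ℂ A] [CompleteSpace A]
    (Ψ : BanachSmooth.AutomorphismGroup d A) (φ : ℕ → BanachSmooth.Rd d → ℝ)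
    (hφ : BanachSmooth.IsDyadicPartition φ) (r : ℝ) (hr : 0 < r) :
    -- `Φ_k * a` is well defined for `a ∈ C(A)`
    (∀ a ∈ Ψ.contElements, ∀ k : ℕ,
      Integrable (fun t : BanachSmooth.Rd d =>
        𝓕⁻ (fun ξ : BanachSmooth.Rd d => (φ k ξ : ℂ)) t • Ψ.psi (-t) a)) ∧
    -- the characterization of `Λ_r(A)`
    (∀ a : A, a ∈ Ψ.zygmundSpace r ↔
      a ∈ Ψ.contElements ∧ Ψ.littlewoodPaley φ r a < ∞) ∧
    -- the quantity is a norm on `Λ_r(A)`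
    (∀ a ∈ Ψ.zygmundSpace r, ∀ b ∈ Ψ.zygmundSpace r,
      a + b ∈ Ψ.zygmundSpace r ∧
      Ψ.littlewoodPaley φ r (a + b) ≤ Ψ.littlewoodPaley φ r a + Ψ.littlewoodPaley φ r b) ∧
    (∀ (c : ℂ), ∀ a ∈ Ψ.zygmundSpace r,
      c • a ∈ Ψ.zygmundSpace r ∧
      Ψ.littlewoodPaley φ r (c • a) = ENNReal.ofReal ‖c‖ * Ψ.littlewoodPaley φ r a) ∧
    (∀ a ∈ Ψ.zygmundSpace r, Ψ.littlewoodPaley φ r a = 0 ↔ a = 0) ∧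
    -- it is equivalent to the norm of `Λ_r(A)`
    (∃ C₁ C₂ : ℝ, 0 < C₁ ∧ 0 < C₂ ∧ ∀ a ∈ Ψ.zygmundSpace r,
      ENNReal.ofReal C₁ * Ψ.zygmundNorm r a ≤ Ψ.littlewoodPaley φ r a ∧
      Ψ.littlewoodPaley φ r a ≤ ENNReal.ofReal C₂ * Ψ.zygmundNorm r a) := by
  have hiff : ∀ a : A, a ∈ Ψ.zygmundSpace r ↔
      a ∈ Ψ.contElements ∧ Ψ.littlewoodPaley φ r a < ∞ := fun a =>
    Ψ.mem_zygmundSpace_iff hφ hr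
  refine ⟨fun a ha k => Ψ.integrable_action (hφ.isMultiplier k).integrable_kernel ha, hiff,
    fun a ha b hb => ?_, fun c a ha => ?_, fun a ha => ?_, ?_⟩
  · obtain ⟨ha, ha'⟩ := (hiff a).1 ha
    obtain ⟨hb, hb'⟩ := (hiff b).1 hb
    have h := Ψ.littlewoodPaley_add_le (r := r) hφ ha hb
    exact ⟨(hiff _).2 ⟨Ψ.contSubmodule.add_mem ha hb,
      h.trans_lt (ENNReal.add_lt_top.2 ⟨ha', hb'⟩)⟩, h⟩
  · obtain ⟨ha, ha'⟩ := (hiff a).1 ha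
    have h := Ψ.littlewoodPaley_smul φ r c a
    refine ⟨(hiff _).2 ⟨Ψ.contSubmodule.smul_mem c ha, ?_⟩, h⟩
    rw [h]
    exact ENNReal.mul_lt_top ENNReal.ofReal_lt_top ha'
  · exact Ψ.littlewoodPaley_eq_zero_iff hφ ((hiff a).1 ha).1
  · obtain ⟨C, hC0, hC⟩ := Ψ.exists_zygmundNorm_le hφ hr
    obtain ⟨C', hC0', hC'⟩ := Ψ.exists_littlewoodPaley_le hφ hr
    refine ⟨C⁻¹, C', inv_pos.2 hC0, hC0', fun a ha => ⟨?_, hC' a ha⟩⟩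
    obtain ⟨ha, hfin⟩ := (hiff a).1 ha
    calc ENNReal.ofReal C⁻¹ * Ψ.zygmundNorm r a
        ≤ ENNReal.ofReal C⁻¹ * (ENNReal.ofReal C * Ψ.littlewoodPaley φ r a) := by
          gcongr
          exact (hC a ha hfin).2
      _ = Ψ.littlewoodPaley φ r a := by
          rw [← mul_assoc, ← ENNReal.ofReal_mul (by positivity), inv_mul_cancel₀ hC0.ne',
            ENNReal.ofReal_one, one_mul]
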